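/- For an integer $k\ge 1$ let $\mathcal S_{12k}(\Gamma,\mathbb Z)$ be the $\mathbb Z$-module of cusp forms of weight $12k$ for $\Gamma=\mathrm{PSL}_2(\mathbb Z)$ whose $q$-expansion at $\infty$ ($q=e^{2\pi i z}$) has integral coefficients, and let $\mathcal S_{12k}(\Gamma,\mathbb Q)$ be the $\mathbb Q$-vector space of those with rational coefficients. Let $\Delta=q\prod_{n\ge1}(1-q^n)^{24}$ and let $j=q^{-1}+744+\cdots$ be the classical $j$-function. For $0\ne f=\sum_{n\ge 1}a_nq^n\in\mathcal S_{12k}(\Gamma,\mathbb Q)$ let $\mathrm{ord}_\infty(f)$ be the smallest $n$ with $a_n\neq0$. Write $f=F(j\Delta,\Delta)$ with $F\in\mathbb Q[Z_0,Z_1]$ homogeneous of degree $k$, i.e. view $f$ as a section of $\mathcal O(k)$ on $\mathbb P^1=\mathrm{Proj}\,\mathbb Z[Z_0,Z_1]$. For a prime $p$ put $$\|f\|_p=\sup_{(x_0:x_1)\in\mathbb P^1(\mathbb C_p)}\frac{|F(x_0,x_1)|_p}{\max(|x_0|_p,|x_1|_p)^k},\qquad \|f\|_\infty^2=\int_{\Gamma\backslash\mathbb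 H}|f(z)|^2(4\pi y)^{12k}\,\frac{dx\,dy}{y^2},$$ and let $\lambda(f)=-\log\|f\|_\infty-\sum_p\log\|f\|_p$ be the logarithmic height of $f$. For $1\le i\le k$ let $\lambda_{i,12k}$ be the largest real number $\lambda$ such that the nonzero $f\in\mathcal S_{12k}(\Gamma,\mathbb Q)$ with $\lambda(f)\ge\lambda$ generate a $\mathbb Q$-vector space of dimension at least $i$. (Such a largest number exists.) For $c>0$ put $\ell(c)=2\pi c+6(\log c+1-\log 12)$. Theorem. For every $k\ge1$, $\mathcal S_{12k}(\Gamma,\mathbb Z)$ has rank $k$ over $\mathbb Z$, and $\{\Delta^kj^{k-\ell}:1\le\ell\le k\}$ is a basis of it over $\mathbb Z$. For all $0\ne f\in\mathcal S_{12k}(\Gamma,\mathbb Z)$ one has $1/k\le\mathrm{ord}_\infty(f)/k\le1$, and replacing $f$ by a nonzero rational multiple of itself changes neither $\lambda(f)$ nor $\mathrm{ord}_\infty(f)$. The function $\ell:\mathbb R_{>0}\to\mathbb R$ is monotonically increasing. Moreover: (i) For every $\epsilon>0$ there are, up to replacing $f$ by a nonzero rational multiple of itself, only finitely many pairs $(k,f)$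 with $k\ge1$ and $0\neq f\in\mathcal S_{12k}(\Gamma,\mathbb Z)$ for which $\lambda(f)/k-\ell(\mathrm{ord}_\infty(f)/k)\ge\epsilon$. (ii) Suppose $r_0>\ell(1)=2\pi+6(1-\log12)=-2.62625\ldots$. Then for all sufficiently large $k$ and all $0\ne f\in\mathcal S_{12k}(\Gamma,\mathbb Z)$ one has $\lambda(f)/k\le r_0$. (iii) Suppose $0<c<1$ and $\epsilon>0$. Then for all sufficiently large $k$ there are at least $ck$ indices $i\in\{1,\dots,k\}$ with $\lambda_{i,12k}/k\le\ell(c)+\epsilon$. One has $\lim_{c\to0^+}\ell(c)=-\infty$. -/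

import Mathlib

open UpperHalfPlane ModularForm MeasureTheory Filter Topology
open scoped MatrixGroups Manifold Modular

noncomputable section

/-- The `ℚ`-vector space structure on the cusp forms for `SL(2, ℤ)`, with pointwise operations. -/
instance cuspFormModuleRat (w : ℤ) : Module ℚ (CuspForm 𝒮ℒ w) :=
  FunLike.module

/-- The lattice of cusp forms of weight `12 k` for `SL(2, ℤ)` whose `q`-expansion at `∞` has
integral coefficients. -/
def cuspFormsInt (k : ℕ) : Submodule ℤ (CuspForm 𝒮ℒ ((12 * k : ℕ) : ℤ)) where
  carrier := {f | ∀ n : ℕ, ∃ a : ℤ, (qExpansion 1 f).coeff n = a}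
  zero_mem' n := ⟨0, by simp [qExpansion_zero]⟩
  add_mem' {f g} hf hg n := by
    obtain ⟨a, ha⟩ := hf n
    obtain ⟨b, hb⟩ := hg n
    refine ⟨a + b, ?_⟩
    have h := ModularForm.qExpansion_add one_pos one_mem_strictPeriods_SL f g
    rw [FunLike.coe_add, h, map_add, ha, hb]
    push_cast
    rfl
  smul_mem' c f hf n := by
    obtain ⟨a, ha⟩ := hf n
    refine ⟨c * a, ?_⟩
    have h := ModularForm.qExpansion_smul one_pos one_mem_strictPeriods_SL (c : ℂ) f
    have e : (⇑(c • f) : ℍ → ℂ) = (c : ℂ) • (f : ℍ → ℂ) := by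
      ext z
      simp
    rw [e, h, PowerSeries.coeff_smul, ha]
    push_cast
    rfl

/-- The `ℚ`-vector space of cusp forms of weight `12 k` for `SL(2, ℤ)` whose `q`-expansion at `∞`
has rational coefficients. -/
def cuspFormsRat (k : ℕ) : Submodule ℚ (CuspForm 𝒮ℒ ((12 * k : ℕ) : ℤ)) where
  carrier := {f | ∀ n : ℕ, ∃ a : ℚ, (qExpansion 1 f).coeff n = a}
  zero_mem' n := ⟨0, by simp [qExpansion_zero]⟩
  add_mem' {f g} hf hg n := by
    obtain ⟨a, ha⟩ := hf n
    obtain ⟨b, hb⟩ := hg n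
    refine ⟨a + b, ?_⟩
    have h := ModularForm.qExpansion_add one_pos one_mem_strictPeriods_SL f g
    rw [FunLike.coe_add, h, map_add, ha, hb]
    push_cast
    rfl
  smul_mem' c f hf n := by
    obtain ⟨a, ha⟩ := hf n
    refine ⟨c * a, ?_⟩
    have h := ModularForm.qExpansion_smul one_pos one_mem_strictPeriods_SL (c : ℂ) f
    have e : (⇑(c • f) : ℍ → ℂ) = (c : ℂ) • (f : ℍ → ℂ) := by
      ext z
      simp [Rat.smul_def]
    rw [e, h, PowerSeries.coeff_smul, ha]
    push_cast
    rfl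

/-- The classical `j`-function `E₄³ / Δ = q⁻¹ + 744 + ⋯`. -/
def kleinJ (z : ℍ) : ℂ := E₄ z ^ 3 / discriminant z

/-- The order of vanishing at the cusp `∞` of a nonzero form: the least `n` for which the
coefficient of `q ^ n` is nonzero. -/
def ordInfty {w : ℤ} (f : CuspForm 𝒮ℒ w) : ℕ := (qExpansion 1 f).order.toNat

/-- `F` is the section of `𝒪(k)` on `ℙ¹ = Proj ℚ[Z₀, Z₁]` (a homogeneous form of degree `k`)
that corresponds to the modular form `f` of weight `12 k`, where `Z₀` and `Z₁` correspond to the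
forms `j Δ` and `Δ` of weight `12`. -/
def IsSectionOf (k : ℕ) (f : CuspForm 𝒮ℒ ((12 * k : ℕ) : ℤ)) (F : MvPolynomial (Fin 2) ℚ) :
    Prop :=
  F.IsHomogeneous k ∧
    ∀ z : ℍ, f z = MvPolynomial.aeval ![kleinJ z * discriminant z, discriminant z] F

open Classical in
/-- The section of `𝒪(k)` on `ℙ¹` over `ℚ` that corresponds to a form with rational
`q`-expansion. -/
def sectionOf (k : ℕ) (f : CuspForm 𝒮ℒ ((12 * k : ℕ) : ℤ)) : MvPolynomial (Fin 2) ℚ :=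
  if h : ∃ F, IsSectionOf k f F then h.choose else 0

/-- The sup norm over `ℙ¹(ℂ_p)` of a section `F` of `𝒪(k)`, for the metric defined by the model
`𝒪(k)` on `Proj ℤ[Z₀, Z₁]`: at the point with homogeneous coordinates `x = (x₀, x₁) ≠ 0` the
section has norm `|F(x)|_p / max(|x₀|_p, |x₁|_p) ^ k`. The norm `‖x‖` on `Fin 2 → ℂ_[p]` is the
maximum of the norms of the coordinates. -/
def padicSupNorm (p : ℕ) [Fact p.Prime] (k : ℕ) (F : MvPolynomial (Fin 2) ℚ) : ℝ :=
  ⨆ x : {x : Fin 2 → ℂ_[p] // x ≠ 0}, ‖MvPolynomial.aeval x.1 F‖ / ‖x.1‖ ^ k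

/-- The norm at the prime `p` of a form of weight `12 k` with rational `q`-expansion. -/
def finiteNorm (p : Nat.Primes) (k : ℕ) (f : CuspForm 𝒮ℒ ((12 * k : ℕ) : ℤ)) : ℝ :=
  haveI : Fact (p : ℕ).Prime := ⟨p.2⟩
  padicSupNorm p k (sectionOf k f)

/-- The Petersson norm of a form of weight `12 k`: the square root of the integral over
`SL(2, ℤ) \ ℍ` of `|f(z)|² (4 π y) ^ (12 k)` for the hyperbolic measure `dx dy / y²`, which is the
standard measure on `ℍ`. -/
def peterssonNorm (k : ℕ) (f : CuspForm 𝒮ℒ ((12 * k : ℕ) : ℤ)) : ℝ :=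
  √(∫ z in 𝒟, ‖f z‖ ^ 2 * (4 * Real.pi * z.im) ^ (12 * k))

/-- The logarithmic height `λ(f) = - ∑ᵥ log ‖f‖ᵥ`, over all places `v` of `ℚ`, of a nonzero form
of weight `12 k` with rational `q`-expansion. -/
def logHeight (k : ℕ) (f : CuspForm 𝒮ℒ ((12 * k : ℕ) : ℤ)) : ℝ :=
  -(Real.log (peterssonNorm k f) + ∑ᶠ p : Nat.Primes, Real.log (finiteNorm p k f))

/-- The real numbers `r` such that the (nonzero) forms of height at least `r` in the rational
space of cusp forms of weight `12 k` generate a `ℚ`-vector space of dimension at least `i`. -/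
def heightLevels (k i : ℕ) : Set ℝ :=
  {r | (i : Cardinal) ≤ Module.rank ℚ
    (Submodule.span ℚ {f | f ∈ cuspFormsRat k ∧ f ≠ 0 ∧ r ≤ logHeight k f})}

/-- The `i`-th naive adelic successive maximum of the cusp forms of weight `12 k`: the largest
element of `heightLevels k i`. -/
def succMax (k i : ℕ) : ℝ := sSup (heightLevels k i)

/-- The function `ℓ(c) = 2 π c + 6 (log c + 1 - log 12)`. -/
def ellBound (c : ℝ) : ℝ := 2 * Real.pi * c + 6 * (Real.log c + 1 - Real.log 12)

end

noncomputable section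

/-! The forms Δ^k j^(k-l) = E₄^(3(k-l)) Δ^l = q^l + ⋯ have integral coefficients and are triangular
in q, so with the Sturm bound they form a ℤ-basis of the lattice. Every nonzero rational form is
therefore a rational multiple of a primitive integral combination g. By Gauss's lemma all p-adic
norms of g are 1, and by the product formula the multiple does not matter, so λ(f) = -log ‖g‖_∞
(`logHeight_eq_of_primitive`).

It remains to bound the Petersson norm of g from below. Let m be the order of g at ∞. Its leading
coefficient is a nonzero integer, hence ∫|g|² dx ≥ e^(-4πmy) on every horizontal segment of length 1
(`norm_qCoeff_sq_le_integral`). Integrating this against (4πy)^(12k) over a thin strip just above y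
= 3k/(πm) + 1 gives λ(f)/k ≤ ℓ(m/k) + O(log k / k) (`logHeight_div_le`). The maximum of
e^(-4πmy)(4πy)^(12k) is at y = 3k/(πm); the shift by 1 keeps the strip inside the fundamental domain
and costs the term 2πc of ℓ(c).

Part (ii) follows because ℓ is increasing and m ≤ k. For (i), the error is below ε outside finitely
many weights, and in each weight only finitely many primitive forms have height bounded below
(`finite_primitiveForms`). For (iii), forms of large height have large order at ∞, hence lie in the
span of few basis forms (`le_of_mem_heightLevels`). -/

/-! ### Coefficients of cusp forms and the triangular family of basis forms -/

/-- The `n`-th coefficient of the `q`-expansion, as a linear functional on cusp forms. -/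
def qCoeff {w : ℤ} (n : ℕ) : CuspForm 𝒮ℒ w →ₗ[ℂ] ℂ where
  toFun f := (qExpansion 1 f).coeff n
  map_add' f g := by
    rw [FunLike.coe_add, ModularForm.qExpansion_add one_pos one_mem_strictPeriods_SL f g, map_add]
  map_smul' c f := by
    rw [FunLike.coe_smul, ModularForm.qExpansion_smul one_pos one_mem_strictPeriods_SL c f,
      PowerSeries.coeff_smul]
    rfl

theorem qCoeff_apply {w : ℤ} (n : ℕ) (f : CuspForm 𝒮ℒ w) :
    qCoeff n f = (qExpansion 1 f).coeff n := rfl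

theorem qCoeff_zero_eq_zero {w : ℤ} (f : CuspForm 𝒮ℒ w) : qCoeff 0 f = 0 :=
  CuspFormClass.qExpansion_coeff_zero f one_pos one_mem_strictPeriods_SL

/-- A cusp form of weight `12 k` is determined by its first `k` coefficients. -/
theorem CuspForm.eq_zero_of_qCoeff {k : ℕ} {f : CuspForm 𝒮ℒ ((12 * k : ℕ) : ℤ)}
    (h : ∀ n ∈ Finset.Icc 1 k, qCoeff n f = 0) : f = 0 := by
  apply CuspForm.toModularFormₗ_injective
  rw [map_zero]
  -- In weight 12k the Sturm bound is k; the coefficient of q^0 vanishes by cuspidality.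
  apply ModularForm.sturm_bound_levelOne_nat
  rw [Nat.mul_div_cancel_left _ (by norm_num)]
  have e : qExpansion 1 (CuspForm.toModularFormₗ f : ℍ → ℂ) = qExpansion 1 (f : ℍ → ℂ) := rfl
  have := PowerSeries.nat_le_order (qExpansion 1 (f : ℍ → ℂ)) (k + 1) (fun i hi ↦ by
    rcases Nat.eq_zero_or_pos i with rfl | h0
    · exact qCoeff_zero_eq_zero f
    · exact h i (Finset.mem_Icc.2 ⟨h0, by omega⟩))
  rw [e]
  refine lt_of_lt_of_le ?_ this
  exact_mod_cast Nat.lt_succ_self k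

theorem CuspForm.eq_of_qCoeff {k : ℕ} {f g : CuspForm 𝒮ℒ ((12 * k : ℕ) : ℤ)}
    (h : ∀ n ∈ Finset.Icc 1 k, qCoeff n f = qCoeff n g) : f = g := by
  rw [← sub_eq_zero]
  apply CuspForm.eq_zero_of_qCoeff
  intro n hn
  rw [map_sub, h n hn, sub_self]

/-- The modular form `E₄ ^ (3 (k - l)) Δ ^ l` of weight `12 k`. -/
def eisensteinDiscriminantForm (k l : ℕ) (h : l ≤ k) : ModularForm 𝒮ℒ ((12 * k : ℕ) : ℤ) :=
  ModularForm.mcast (by push_cast [h]; ring)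
    ((E₄.pow (3 * (k - l))).mul ((CuspForm.toModularFormₗ CuspForm.discriminant).pow l))

theorem eisensteinDiscriminantForm_apply (k l : ℕ) (h : l ≤ k) (z : ℍ) :
    eisensteinDiscriminantForm k l h z = E₄ z ^ (3 * (k - l)) * ModularForm.discriminant z ^ l := by
  change (E₄.pow (3 * (k - l)) : ℍ → ℂ) z *
    ((CuspForm.toModularFormₗ CuspForm.discriminant).pow l : ℍ → ℂ) z = _
  rw [coe_pow, coe_pow]
  rfl

theorem qExpansion_eisensteinDiscriminantForm (k l : ℕ) (h : l ≤ k) :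
    qExpansion 1 (eisensteinDiscriminantForm k l h) =
      qExpansion 1 E₄ ^ (3 * (k - l)) * qExpansion 1 ModularForm.discriminant ^ l := by
  rw [eisensteinDiscriminantForm, ModularForm.qExpansion_mcast,
    ModularForm.qExpansion_mul one_pos one_mem_strictPeriods_SL,
    ModularForm.qExpansion_pow one_pos one_mem_strictPeriods_SL,
    ModularForm.qExpansion_pow one_pos one_mem_strictPeriods_SL]
  rfl

/-- With one factor q split off from Δ, the expansion of E₄^(3(k-l)) Δ^l is visibly q^l times a
series with constant term 1. -/
theorem qExpansion_discriminant_dvd :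
    ∃ u : PowerSeries ℂ, qExpansion 1 ModularForm.discriminant = PowerSeries.X * u ∧
      u.coeff 0 = 1 := by
  obtain ⟨u, hu⟩ := PowerSeries.X_dvd_iff.2 (show PowerSeries.constantCoeff
    (qExpansion 1 ModularForm.discriminant) = 0 by
      rw [← PowerSeries.coeff_zero_eq_constantCoeff_apply]
      exact qCoeff_zero_eq_zero CuspForm.discriminant)
  refine ⟨u, hu, ?_⟩
  have := discriminant_qExpansion_coeff_one
  rwa [hu, show 1 = 0 + 1 from rfl, PowerSeries.coeff_succ_X_mul] at this

theorem qExpansion_E₄_coeff_zero : (qExpansion 1 E₄).coeff 0 = 1 :=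
  EisensteinSeries.E_qExpansion_coeff_zero _ ⟨2, rfl⟩

theorem coeff_eisensteinDiscriminantForm_of_lt {k l n : ℕ} (h : l ≤ k) (hn : n < l) :
    (qExpansion 1 (eisensteinDiscriminantForm k l h)).coeff n = 0 := by
  obtain ⟨u, hu, -⟩ := qExpansion_discriminant_dvd
  rw [qExpansion_eisensteinDiscriminantForm, hu, mul_pow, mul_left_comm,
    PowerSeries.coeff_X_pow_mul', if_neg (by omega)]

theorem coeff_eisensteinDiscriminantForm_self {k l : ℕ} (h : l ≤ k) :
    (qExpansion 1 (eisensteinDiscriminantForm k l h)).coeff l = 1 := by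
  obtain ⟨u, hu, hu0⟩ := qExpansion_discriminant_dvd
  have h4 := qExpansion_E₄_coeff_zero
  rw [qExpansion_eisensteinDiscriminantForm, hu, mul_pow, mul_left_comm,
    PowerSeries.coeff_X_pow_mul', if_pos le_rfl, Nat.sub_self]
  rw [PowerSeries.coeff_zero_eq_constantCoeff_apply] at *
  rw [map_mul, map_pow, map_pow, h4, hu0, one_pow, one_pow, one_mul]

/-- The cusp form `Δ ^ k j ^ (k - l) = E₄ ^ (3 (k - l)) Δ ^ l` for `1 ≤ l ≤ k` (and `0` otherwise). -/
def basisForm (k l : ℕ) : CuspForm 𝒮ℒ ((12 * k : ℕ) : ℤ) :=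
  if h : 1 ≤ l ∧ l ≤ k then
    ModularForm.toCuspForm (eisensteinDiscriminantForm k l h.2)
      (coeff_eisensteinDiscriminantForm_of_lt h.2 h.1)
  else 0

theorem coe_basisForm {k l : ℕ} (h1 : 1 ≤ l) (h2 : l ≤ k) :
    (basisForm k l : ℍ → ℂ) = eisensteinDiscriminantForm k l h2 := by
  rw [basisForm, dif_pos ⟨h1, h2⟩]
  rfl

theorem basisForm_apply {k l : ℕ} (h1 : 1 ≤ l) (h2 : l ≤ k) (z : ℍ) :
    basisForm k l z = E₄ z ^ (3 * (k - l)) * ModularForm.discriminant z ^ l := by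
  rw [coe_basisForm h1 h2, eisensteinDiscriminantForm_apply]

theorem kleinJ_mul_discriminant (z : ℍ) : kleinJ z * ModularForm.discriminant z = E₄ z ^ 3 :=
  div_mul_cancel₀ _ (discriminant_ne_zero z)

theorem basisForm_apply_kleinJ {k l : ℕ} (h1 : 1 ≤ l) (h2 : l ≤ k) (z : ℍ) :
    basisForm k l z = ModularForm.discriminant z ^ k * kleinJ z ^ (k - l) := by
  rw [basisForm_apply h1 h2, pow_mul, ← kleinJ_mul_discriminant, mul_pow, mul_assoc, ← pow_add,
    Nat.sub_add_cancel h2, mul_comm]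

theorem qCoeff_basisForm_of_lt {k l n : ℕ} (hn : n < l) : qCoeff n (basisForm k l) = 0 := by
  by_cases h : 1 ≤ l ∧ l ≤ k
  · rw [qCoeff_apply, coe_basisForm h.1 h.2, coeff_eisensteinDiscriminantForm_of_lt h.2 hn]
  · rw [basisForm, dif_neg h, map_zero]

theorem qCoeff_basisForm_self {k l : ℕ} (h1 : 1 ≤ l) (h2 : l ≤ k) :
    qCoeff l (basisForm k l) = 1 := by
  rw [qCoeff_apply, coe_basisForm h1 h2, coeff_eisensteinDiscriminantForm_self h2]

/-! ### Integrality of the `q`-expansions -/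

/-- The power series whose coefficients lie in a subring. -/
def PowerSeries.coeffSubring (R : Subring ℂ) : Subring (PowerSeries ℂ) where
  carrier := {P | ∀ n, P.coeff n ∈ R}
  mul_mem' {P Q} hP hQ n := by
    rw [PowerSeries.coeff_mul]
    exact R.sum_mem fun p _ ↦ R.mul_mem (hP _) (hQ _)
  one_mem' n := by
    rw [PowerSeries.coeff_one]
    split_ifs
    exacts [R.one_mem, R.zero_mem]
  add_mem' {P Q} hP hQ n := by
    rw [map_add]
    exact R.add_mem (hP n) (hQ n)
  zero_mem' n := by
    rw [map_zero]
    exact R.zero_mem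
  neg_mem' {P} hP n := by
    rw [map_neg]
    exact R.neg_mem (hP n)

theorem qExpansion_E₄_eq : qExpansion 1 E₄ = 1 + 240 *
    PowerSeries.mk fun n ↦ (ArithmeticFunction.sigma 3 n : ℂ) := by
  ext n
  rw [EisensteinSeries.E_qExpansion_coeff _ ⟨2, rfl⟩, show (240 : PowerSeries ℂ) =
    PowerSeries.C (240 : ℂ) from rfl, map_add, PowerSeries.coeff_C_mul, PowerSeries.coeff_mk,
    PowerSeries.coeff_one]
  split_ifs with h
  · simp [h]
  · have h1 := E₄_qExpansion_coeff_one
    rw [EisensteinSeries.E_qExpansion_coeff _ ⟨2, rfl⟩, if_neg one_ne_zero,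
      ArithmeticFunction.sigma_one, Nat.cast_one, mul_one] at h1
    rw [h1, zero_add]

theorem qExpansion_E₆_eq : qExpansion 1 E₆ = 1 - 504 *
    PowerSeries.mk fun n ↦ (ArithmeticFunction.sigma 5 n : ℂ) := by
  ext n
  rw [EisensteinSeries.E_qExpansion_coeff _ ⟨3, rfl⟩, show (504 : PowerSeries ℂ) =
    PowerSeries.C (504 : ℂ) from rfl, map_sub, PowerSeries.coeff_C_mul, PowerSeries.coeff_mk,
    PowerSeries.coeff_one]
  split_ifs with h
  · simp [h]
  · have h1 := E₆_qExpansion_coeff_one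
    rw [EisensteinSeries.E_qExpansion_coeff _ ⟨3, rfl⟩, if_neg one_ne_zero,
      ArithmeticFunction.sigma_one, Nat.cast_one, mul_one] at h1
    rw [h1, neg_mul, zero_sub]

/-- Each divisor contributes d³(5 + 7d²), which vanishes modulo 12. This is the congruence that
makes (E₄³ - E₆²)/1728 integral. -/
theorem twelve_dvd_sigma (n : ℕ) :
    12 ∣ 5 * ArithmeticFunction.sigma 3 n + 7 * ArithmeticFunction.sigma 5 n := by
  rw [ArithmeticFunction.sigma_apply, ArithmeticFunction.sigma_apply, Finset.mul_sum,
    Finset.mul_sum, ← Finset.sum_add_distrib]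
  refine Finset.dvd_sum fun d _ ↦ ?_
  rw [← ZMod.natCast_eq_zero_iff]
  push_cast
  generalize (d : ZMod 12) = x
  revert x
  decide

theorem qExpansion_discriminant_eq : (1728 : ℂ) • qExpansion 1 ModularForm.discriminant =
    qExpansion 1 E₄ ^ 3 - qExpansion 1 E₆ ^ 2 := by
  rw [← ModularForm.qExpansion_pow one_pos one_mem_strictPeriods_SL,
    ← ModularForm.qExpansion_pow one_pos one_mem_strictPeriods_SL,
    ← CuspForm.coe_discriminant, ← ModularForm.qExpansion_smul one_pos one_mem_strictPeriods_SL,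
    ← ModularForm.qExpansion_sub one_pos one_mem_strictPeriods_SL]
  congr 1
  ext z
  have := ModularForm.discriminant_eq_E₄_cube_sub_E₆_sq z
  simp only [Pi.smul_apply, Pi.sub_apply, CuspForm.coe_discriminant, coe_pow, Pi.pow_apply,
    smul_eq_mul, this]
  ring

theorem qExpansion_E₄_mem (R : Subring ℂ) : qExpansion 1 E₄ ∈ PowerSeries.coeffSubring R := by
  rw [qExpansion_E₄_eq]
  refine add_mem (one_mem _) (mul_mem (natCast_mem _ 240) fun n ↦ ?_)
  rw [PowerSeries.coeff_mk]
  exact natCast_mem R _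

theorem qExpansion_discriminant_mem (R : Subring ℂ) :
    qExpansion 1 ModularForm.discriminant ∈ PowerSeries.coeffSubring R := by
  set A : PowerSeries ℂ := PowerSeries.mk fun n ↦ (ArithmeticFunction.sigma 3 n : ℂ) with hA
  set B : PowerSeries ℂ := PowerSeries.mk fun n ↦ (ArithmeticFunction.sigma 5 n : ℂ) with hB
  choose t ht using twelve_dvd_sigma
  have hAR : A ∈ PowerSeries.coeffSubring R := fun n ↦ by
    rw [hA, PowerSeries.coeff_mk]; exact natCast_mem R _
  have hBR : B ∈ PowerSeries.coeffSubring R := fun n ↦ by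
    rw [hB, PowerSeries.coeff_mk]; exact natCast_mem R _
  have hT : PowerSeries.mk (fun n ↦ (t n : ℂ)) ∈ PowerSeries.coeffSubring R := fun n ↦ by
    rw [PowerSeries.coeff_mk]; exact natCast_mem R _
  have h12 : 5 * A + 7 * B = 12 * PowerSeries.mk (fun n ↦ (t n : ℂ)) := by
    ext n
    rw [show (5 : PowerSeries ℂ) = PowerSeries.C (5 : ℂ) from rfl,
      show (7 : PowerSeries ℂ) = PowerSeries.C (7 : ℂ) from rfl,
      show (12 : PowerSeries ℂ) = PowerSeries.C (12 : ℂ) from rfl, map_add,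
      PowerSeries.coeff_C_mul, PowerSeries.coeff_C_mul, PowerSeries.coeff_C_mul, hA, hB,
      PowerSeries.coeff_mk, PowerSeries.coeff_mk, PowerSeries.coeff_mk]
    exact_mod_cast ht n
  have key : qExpansion 1 ModularForm.discriminant =
      PowerSeries.mk (fun n ↦ (t n : ℂ)) + 100 * A ^ 2 + 8000 * A ^ 3 - 147 * B ^ 2 := by
    have h := qExpansion_discriminant_eq
    rw [qExpansion_E₄_eq, qExpansion_E₆_eq, ← hA, ← hB, PowerSeries.smul_eq_C_mul,
      show PowerSeries.C (1728 : ℂ) = (1728 : PowerSeries ℂ) from rfl] at h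
    have h0 : (1728 : PowerSeries ℂ) ≠ 0 := by
      rw [show (1728 : PowerSeries ℂ) = PowerSeries.C (1728 : ℂ) from rfl]
      intro h
      have := congrArg PowerSeries.constantCoeff h
      norm_num at this
    apply mul_left_cancel₀ h0
    rw [h]
    -- Expanding (1 + 240A)³ - (1 - 504B)², the linear part is 144(5A + 7B), and every other
    -- coefficient is divisible by 1728.
    linear_combination 144 * h12
  rw [key]
  exact sub_mem (add_mem (add_mem hT (mul_mem (natCast_mem _ 100) (pow_mem hAR 2)))
    (mul_mem (natCast_mem _ 8000) (pow_mem hAR 3))) (mul_mem (natCast_mem _ 147) (pow_mem hBR 2))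

/-- An arbitrary subring `R` lets the integral and the rational case share one argument. -/
theorem qCoeff_basisForm_mem (R : Subring ℂ) (k l n : ℕ) : qCoeff n (basisForm k l) ∈ R := by
  by_cases h : 1 ≤ l ∧ l ≤ k
  · rw [qCoeff_apply, coe_basisForm h.1 h.2, qExpansion_eisensteinDiscriminantForm]
    exact mul_mem (pow_mem (qExpansion_E₄_mem R) _) (pow_mem (qExpansion_discriminant_mem R) _) n
  · rw [basisForm, dif_neg h, map_zero]
    exact R.zero_mem

/-! ### Coordinates with respect to the basis forms -/

/-- The linear combination of the basis forms with coefficients `c`. -/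
def basisComb (k : ℕ) (c : ℕ → ℂ) : CuspForm 𝒮ℒ ((12 * k : ℕ) : ℤ) :=
  ∑ l ∈ Finset.Icc 1 k, c l • basisForm k l

theorem qCoeff_basisComb (k n : ℕ) (c : ℕ → ℂ) :
    qCoeff n (basisComb k c) = ∑ l ∈ Finset.Icc 1 k, c l * qCoeff n (basisForm k l) := by
  simp [basisComb]

/-- Triangularity: basis forms of index above `n` have no q^n term, and those of index below `n` do
not occur. Coordinates can thus be read off one after another. -/
theorem qCoeff_basisComb_of_forall_lt {k n : ℕ} {c : ℕ → ℂ} (hn : 1 ≤ n) (hk : n ≤ k)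
    (h : ∀ l ∈ Finset.Icc 1 k, l < n → c l = 0) : qCoeff n (basisComb k c) = c n := by
  rw [qCoeff_basisComb, Finset.sum_eq_single n, qCoeff_basisForm_self hn hk, mul_one]
  · intro l hl hln
    rcases lt_or_gt_of_ne hln with h' | h'
    · rw [h l hl h', zero_mul]
    · rw [qCoeff_basisForm_of_lt h', mul_zero]
  · intro h'
    exact absurd (Finset.mem_Icc.2 ⟨hn, hk⟩) h'

theorem basisComb_eq_zero {k : ℕ} {c : ℕ → ℂ} (h : basisComb k c = 0) :
    ∀ l ∈ Finset.Icc 1 k, c l = 0 := by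
  intro l
  induction l using Nat.strong_induction_on with | _ l ih =>
  intro hl
  rw [← qCoeff_basisComb_of_forall_lt (Finset.mem_Icc.1 hl).1 (Finset.mem_Icc.1 hl).2
    (fun m hm hml ↦ ih m hml hm), h, map_zero]

/-- A cusp form whose `q`-expansion has coefficients in `R` is an `R`-linear combination of the
basis forms. -/
theorem exists_basisComb_eq (R : Subring ℂ) {k : ℕ} {f : CuspForm 𝒮ℒ ((12 * k : ℕ) : ℤ)}
    (hf : ∀ n, qCoeff n f ∈ R) : ∃ c : ℕ → ℂ, (∀ l, c l ∈ R) ∧ f = basisComb k c := by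
  have key : ∀ n ≤ k, ∃ c : ℕ → ℂ, (∀ l, c l ∈ R) ∧
      ∀ m ∈ Finset.Icc 1 n, qCoeff m f = qCoeff m (basisComb k c) := by
    intro n
    induction n with
    | zero => exact fun _ ↦ ⟨0, fun _ ↦ R.zero_mem, by simp⟩
    | succ n ih =>
      intro hn
      obtain ⟨c, hc, hcf⟩ := ih (by omega)
      -- Adding `d` times the form of index `n + 1` corrects this coefficient and leaves the earlier
      -- ones alone.
      set d := qCoeff (n + 1) f - qCoeff (n + 1) (basisComb k c) with hd
      have hdR : d ∈ R := by
        refine R.sub_mem (hf _) ?_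
        rw [qCoeff_basisComb]
        exact R.sum_mem fun l _ ↦ R.mul_mem (hc l) (qCoeff_basisForm_mem R _ _ _)
      refine ⟨c + Pi.single (n + 1) d, fun l ↦ ?_, fun m hm ↦ ?_⟩
      · rw [Pi.add_apply, Pi.single_apply]
        split_ifs
        · exact R.add_mem (hc l) hdR
        · exact R.add_mem (hc l) R.zero_mem
      · have e : qCoeff m (basisComb k (c + Pi.single (n + 1) d)) =
            qCoeff m (basisComb k c) + d * qCoeff m (basisForm k (n + 1)) := by
          simp only [qCoeff_basisComb, Pi.add_apply, add_mul, Finset.sum_add_distrib]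
          congr 1
          rw [Finset.sum_eq_single (n + 1), Pi.single_eq_same]
          · intro l _ hl
            rw [Pi.single_eq_of_ne hl, zero_mul]
          · intro h
            exact absurd (Finset.mem_Icc.2 ⟨by omega, hn⟩) h
        rw [e]
        rw [Finset.mem_Icc] at hm
        rcases Nat.lt_or_ge m (n + 1) with h | h
        · rw [qCoeff_basisForm_of_lt h, mul_zero, add_zero, hcf m (Finset.mem_Icc.2 ⟨hm.1, by omega⟩)]
        · obtain rfl : m = n + 1 := by omega
          rw [qCoeff_basisForm_self (by omega) hn, mul_one, hd]
          ring
  obtain ⟨c, hc, hcf⟩ := key k le_rfl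
  exact ⟨c, hc, CuspForm.eq_of_qCoeff hcf⟩

/-! ### The product formula for `ℚ` -/

/-- The prime factors of `n`, as a finite set in the type of primes. -/
def Nat.primesDividing (n : ℕ) : Finset Nat.Primes := n.primeFactors.subtype Nat.Prime

/-- Finite support is essential: `∑ᶠ` takes the default value 0 otherwise. -/
theorem support_factorization_mul_log_subset (n : ℕ) :
    (Function.support fun p : Nat.Primes ↦ (n.factorization p : ℝ) * Real.log p) ⊆
      (n.primesDividing : Set Nat.Primes) := by
  intro p hp
  refine Finset.mem_subtype.2 ?_
  rw [← Nat.support_factorization, Finsupp.mem_support_iff]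
  intro h
  apply hp
  simp only
  rw [show n.factorization (p : ℕ) = 0 from h, Nat.cast_zero, zero_mul]

theorem finsum_factorization_mul_log (n : ℕ) :
    ∑ᶠ p : Nat.Primes, (n.factorization p : ℝ) * Real.log p = Real.log n := by
  rw [finsum_eq_sum_of_support_subset _ (support_factorization_mul_log_subset n),
    Real.log_nat_eq_sum_factorization, Finsupp.sum, Nat.support_factorization]
  exact Finset.sum_subtype_of_mem (fun p : ℕ ↦ (n.factorization p : ℝ) * Real.log p)
    fun p hp ↦ Nat.prime_of_mem_primeFactors hp

/-- The product formula: the logarithms of the `p`-adic absolute values of a nonzero rational number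
sum to `- log |a|`. -/
theorem finsum_log_padicNorm {a : ℚ} (ha : a ≠ 0) :
    ∑ᶠ p : Nat.Primes, Real.log (padicNorm p a) = -Real.log |(a : ℝ)| := by
  have e : ∀ p : Nat.Primes, Real.log (padicNorm p a) =
      (a.den.factorization p : ℝ) * Real.log p - (a.num.natAbs.factorization p : ℝ) * Real.log p := by
    intro p
    rw [padicNorm.eq_zpow_of_nonzero ha, padicValRat, padicValInt, Nat.factorization_def _ p.2,
      Nat.factorization_def _ p.2, Rat.cast_zpow, Rat.cast_natCast, Real.log_zpow, Int.cast_neg,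
      Int.cast_sub, Int.cast_natCast, Int.cast_natCast]
    ring
  rw [finsum_congr e, finsum_sub_distrib, finsum_factorization_mul_log,
    finsum_factorization_mul_log]
  · rw [← Real.log_div, ← Real.log_inv]
    · congr 1
      conv_rhs => rw [← Rat.num_div_den a]
      push_cast
      rw [abs_div, inv_div, Nat.cast_natAbs, Nat.abs_cast, Int.cast_abs]
    · exact_mod_cast a.den_ne_zero
    · exact_mod_cast Int.natAbs_ne_zero.2 (Rat.num_ne_zero.2 ha)
  · exact (Finset.finite_toSet _).subset (support_factorization_mul_log_subset _)
  · exact (Finset.finite_toSet _).subset (support_factorization_mul_log_subset _)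

/-! ### Binary forms and their `p`-adic sup norms -/

/-- The binary form `∑ c_l Z₀ ^ (k - l) Z₁ ^ l` of degree `k`. -/
def sectionPoly (k : ℕ) (c : ℕ → ℚ) : MvPolynomial (Fin 2) ℚ :=
  ∑ l ∈ Finset.range (k + 1),
    MvPolynomial.C (c l) * MvPolynomial.X 0 ^ (k - l) * MvPolynomial.X 1 ^ l

theorem isHomogeneous_sectionPoly (k : ℕ) (c : ℕ → ℚ) : (sectionPoly k c).IsHomogeneous k := by
  refine MvPolynomial.IsHomogeneous.sum _ _ _ fun l hl ↦ ?_
  have h := ((MvPolynomial.isHomogeneous_C (Fin 2) (c l)).mul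
    (MvPolynomial.isHomogeneous_X_pow (R := ℚ) (0 : Fin 2) (k - l))).mul
    (MvPolynomial.isHomogeneous_X_pow (R := ℚ) (1 : Fin 2) l)
  rw [Finset.mem_range] at hl
  rwa [show 0 + (k - l) + l = k by omega] at h

theorem aeval_sectionPoly {A : Type*} [CommRing A] [Algebra ℚ A] (k : ℕ) (c : ℕ → ℚ)
    (x : Fin 2 → A) : MvPolynomial.aeval x (sectionPoly k c) =
      ∑ l ∈ Finset.range (k + 1), algebraMap ℚ A (c l) * x 0 ^ (k - l) * x 1 ^ l := by
  simp [sectionPoly]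

theorem sectionPoly_term_eq_monomial (i j : ℕ) (a : ℚ) :
    (MvPolynomial.C a * MvPolynomial.X 0 ^ i * MvPolynomial.X 1 ^ j : MvPolynomial (Fin 2) ℚ) =
      MvPolynomial.monomial (Finsupp.single 0 i + Finsupp.single 1 j) a := by
  rw [MvPolynomial.X_pow_eq_monomial, MvPolynomial.X_pow_eq_monomial,
    MvPolynomial.C_mul_monomial, MvPolynomial.monomial_mul, mul_one, mul_one]

theorem exists_eq_sectionPoly {k : ℕ} {F : MvPolynomial (Fin 2) ℚ} (hF : F.IsHomogeneous k) :
    ∃ c, F = sectionPoly k c := by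
  refine ⟨fun l ↦ F.coeff (Finsupp.single 0 (k - l) + Finsupp.single 1 l), ?_⟩
  ext d
  have hd : Finsupp.degree d = d 0 + d 1 := by
    rw [Finsupp.degree_eq_sum, Fin.sum_univ_two]
  by_cases h : d 0 + d 1 = k
  · have hd' : Finsupp.single 0 (k - d 1) + Finsupp.single 1 (d 1) = d := by
      ext i
      fin_cases i
      · simp; omega
      · simp
    simp only [sectionPoly, sectionPoly_term_eq_monomial, MvPolynomial.coeff_sum]
    rw [Finset.sum_eq_single (d 1), MvPolynomial.coeff_monomial, if_pos hd', hd']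
    · intro l _ hl
      rw [MvPolynomial.coeff_monomial, if_neg]
      intro h'
      apply hl
      rw [← h']
      simp
    · intro h'
      exact absurd (Finset.mem_range.2 (by omega)) h'
  · rw [hF.coeff_eq_zero (by rwa [hd]), (isHomogeneous_sectionPoly k _).coeff_eq_zero (by rwa [hd])]

theorem PadicComplex.norm_ratCast (p : ℕ) [Fact p.Prime] (a : ℚ) :
    ‖(a : ℂ_[p])‖ = padicNorm p a := by
  rw [← Padic.eq_padicNorm, ← PadicComplex.norm_extends', map_ratCast]
  congr 1
  exact (map_ratCast (algebraMap (PadicAlgCl p) ℂ_[p]) a).symm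

theorem padicSupNorm_smul (p : ℕ) [Fact p.Prime] (k : ℕ) (a : ℚ) (F : MvPolynomial (Fin 2) ℚ) :
    padicSupNorm p k (a • F) = padicNorm p a * padicSupNorm p k F := by
  rw [padicSupNorm, padicSupNorm, Real.mul_iSup_of_nonneg (by exact_mod_cast padicNorm.nonneg a)]
  congr 1
  ext x
  rw [MvPolynomial.smul_eq_C_mul, map_mul, MvPolynomial.aeval_C, eq_ratCast, norm_mul,
    mul_div_assoc, PadicComplex.norm_ratCast]

theorem sum_pow_of_pow_eq_one {K : Type*} [Field K] [DecidableEq K] {x : K} {n : ℕ} (hx : x ^ n = 1) :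
    ∑ j ∈ Finset.range n, x ^ j = if x = 1 then (n : K) else 0 := by
  split_ifs with h
  · simp [h]
  · rw [geom_sum_eq h, hx, sub_self, zero_div]

/-- The coefficients of a polynomial of degree less than `n` from its values at the `n`-th roots of
unity. -/
theorem IsPrimitiveRoot.sum_mul_sum_pow {K : Type*} [Field K] {ζ : K} {n : ℕ}
    (hζ : IsPrimitiveRoot ζ n) {k l : ℕ} (hk : k < n) (hl : l ≤ k) (c : ℕ → K) :
    ∑ j ∈ Finset.range n, (ζ ^ j) ^ (n - l) * ∑ m ∈ Finset.range (k + 1), c m * (ζ ^ j) ^ m =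
      n * c l := by
  classical
  have e : ∀ j, (ζ ^ j) ^ (n - l) * ∑ m ∈ Finset.range (k + 1), c m * (ζ ^ j) ^ m =
      ∑ m ∈ Finset.range (k + 1), c m * (ζ ^ (n - l + m)) ^ j := by
    intro j
    rw [Finset.mul_sum]
    refine Finset.sum_congr rfl fun m _ ↦ ?_
    rw [mul_left_comm, ← pow_add, ← pow_mul, ← pow_mul, mul_comm j]
  rw [Finset.sum_congr rfl fun j _ ↦ e j, Finset.sum_comm, Finset.sum_eq_single l]
  · rw [← Finset.mul_sum, Nat.sub_add_cancel (by omega), hζ.pow_eq_one]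
    simp [mul_comm]
  · intro m hm hml
    rw [Finset.mem_range] at hm
    rw [← Finset.mul_sum, sum_pow_of_pow_eq_one, if_neg, mul_zero]
    · rw [hζ.pow_eq_one_iff_dvd]
      rintro ⟨t, ht⟩
      -- The exponent n - l + m lies strictly between 0 and 2n, so divisibility by n forces m = l.
      have h1 : 0 < n * t := by omega
      have h2 : n * t < n * 2 := by omega
      obtain rfl : t = 1 := by
        have := Nat.pos_of_mul_pos_left h1
        have := Nat.lt_of_mul_lt_mul_left h2
        omega
      omega
    · rw [← pow_mul, mul_comm, pow_mul, hζ.pow_eq_one, one_pow]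
  · intro h
    exact absurd (Finset.mem_range.2 (by omega)) h

theorem padicNorm_intCast_eq_one_of_not_dvd {p : ℕ} [Fact p.Prime] {m : ℤ} (h : ¬ (p : ℤ) ∣ m) :
    padicNorm p m = 1 := (padicNorm.int_eq_one_iff m).2 h

/-- Gauss's lemma: the sup norm of a primitive integral binary form is `1`. -/
theorem padicSupNorm_sectionPoly_eq_one (p : ℕ) [Fact p.Prime] {k : ℕ} {c : ℕ → ℤ} {l : ℕ}
    (hl : l ≤ k) (hc : ¬ (p : ℤ) ∣ c l) :
    padicSupNorm p k (sectionPoly k fun m ↦ (c m : ℚ)) = 1 := by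
  have hle : ∀ m, ‖algebraMap ℚ ℂ_[p] (c m : ℚ)‖ ≤ 1 := fun m ↦ by
    rw [eq_ratCast, PadicComplex.norm_ratCast]
    exact_mod_cast padicNorm.of_int (c m)
  have upper : ∀ x : Fin 2 → ℂ_[p],
      ‖MvPolynomial.aeval x (sectionPoly k fun m ↦ (c m : ℚ))‖ ≤ ‖x‖ ^ k := by
    intro x
    rw [aeval_sectionPoly]
    refine IsUltrametricDist.norm_sum_le_of_forall_le_of_nonneg (by positivity) fun m hm ↦ ?_
    rw [Finset.mem_range] at hm
    rw [norm_mul, norm_mul, norm_pow, norm_pow]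
    calc _ ≤ 1 * ‖x‖ ^ (k - m) * ‖x‖ ^ m := by
          gcongr
          exacts [hle m, norm_le_pi_norm x 0, norm_le_pi_norm x 1]
      _ = ‖x‖ ^ k := by rw [one_mul, ← pow_add]; congr 1; omega
  have hbdd : ∀ x : {x : Fin 2 → ℂ_[p] // x ≠ 0},
      ‖MvPolynomial.aeval x.1 (sectionPoly k fun m ↦ (c m : ℚ))‖ / ‖x.1‖ ^ k ≤ 1 :=
    fun x ↦ div_le_one_of_le₀ (upper x.1) (by positivity)
  apply le_antisymm
  · exact Real.iSup_le hbdd zero_le_one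
  by_contra! hlt
  -- This `n` exceeds `k` and is prime to `p`. Then `n * c l` has norm 1 and is a sum of values of
  -- the form at n-th roots of unity times units, so some value has norm at least 1.
  set n := p * k + 1 with hn
  have hp2 : 2 ≤ p := (Fact.out : p.Prime).two_le
  have hkn : k < n := by nlinarith
  have : NeZero (n : ℂ_[p]) := ⟨Nat.cast_ne_zero.2 (by omega)⟩
  have := IsSepClosed.hasEnoughRootsOfUnity ℂ_[p] n
  obtain ⟨ζ, hζ⟩ := HasEnoughRootsOfUnity.exists_primitiveRoot ℂ_[p] n
  have hζ1 : ‖ζ‖ = 1 := by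
    have h := congrArg norm hζ.pow_eq_one
    rw [norm_pow, norm_one] at h
    exact (pow_eq_one_iff_of_nonneg (norm_nonneg _) (by omega)).1 h
  have hval : ∀ j, ‖∑ m ∈ Finset.range (k + 1), algebraMap ℚ ℂ_[p] (c m : ℚ) * (ζ ^ j) ^ m‖ ≤
      padicSupNorm p k (sectionPoly k fun m ↦ (c m : ℚ)) := by
    intro j
    have hx : ‖(![1, ζ ^ j] : Fin 2 → ℂ_[p])‖ = 1 := by
      apply le_antisymm
      · rw [pi_norm_le_iff_of_nonneg zero_le_one]
        intro i
        fin_cases i <;> simp [hζ1]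
      · have := norm_le_pi_norm (![1, ζ ^ j] : Fin 2 → ℂ_[p]) 0
        simpa using this
    have hx0 : (![1, ζ ^ j] : Fin 2 → ℂ_[p]) ≠ 0 := by
      intro h
      rw [h, norm_zero] at hx
      exact zero_ne_one hx
    have h := le_ciSup (f := fun x : {x : Fin 2 → ℂ_[p] // x ≠ 0} ↦
      ‖MvPolynomial.aeval x.1 (sectionPoly k fun m ↦ (c m : ℚ))‖ / ‖x.1‖ ^ k)
      ⟨1, by rintro _ ⟨x, rfl⟩; exact hbdd x⟩ ⟨_, hx0⟩
    simp only [hx, one_pow, div_one] at h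
    refine le_trans (le_of_eq ?_) h
    simp [aeval_sectionPoly]
  have key := hζ.sum_mul_sum_pow hkn hl fun m ↦ algebraMap ℚ ℂ_[p] (c m : ℚ)
  have h1 : ‖(n : ℂ_[p]) * algebraMap ℚ ℂ_[p] (c l : ℚ)‖ = 1 := by
    rw [norm_mul, eq_ratCast, PadicComplex.norm_ratCast, padicNorm_intCast_eq_one_of_not_dvd hc,
      show (n : ℂ_[p]) = ((n : ℚ) : ℂ_[p]) by push_cast; rfl, PadicComplex.norm_ratCast,
      (padicNorm.nat_eq_one_iff n).2 ?_]
    · norm_num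
    · rw [hn, Nat.dvd_add_right (dvd_mul_right p k), Nat.dvd_one]
      omega
  have hS0 : 0 ≤ padicSupNorm p k (sectionPoly k fun m ↦ (c m : ℚ)) :=
    (norm_nonneg _).trans (hval 0)
  have h2 : ‖(n : ℂ_[p]) * algebraMap ℚ ℂ_[p] (c l : ℚ)‖ ≤
      padicSupNorm p k (sectionPoly k fun m ↦ (c m : ℚ)) := by
    rw [← key]
    refine IsUltrametricDist.norm_sum_le_of_forall_le_of_nonneg hS0 fun j _ ↦ ?_
    rw [norm_mul, norm_pow, norm_pow, hζ1, one_pow, one_pow, one_mul]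
    exact hval j
  linarith

/-! ### The section of a cusp form -/

theorem Finset.sum_Icc_one_eq_sum_range {M : Type*} [AddCommMonoid M] (k : ℕ) (g : ℕ → M) :
    ∑ l ∈ Finset.Icc 1 k, g l = ∑ l ∈ Finset.range k, g (l + 1) := by
  rw [Finset.range_eq_Ico, Finset.sum_Ico_add' g 0 k 1]
  rfl

/-- The monomial Z₀^k must be absent: it corresponds to E₄^(3k), which is not a cusp form. -/
theorem isSectionOf_sectionPoly {k : ℕ} {c : ℕ → ℚ} (hc : c 0 = 0) :
    IsSectionOf k (basisComb k fun l ↦ (c l : ℂ)) (sectionPoly k c) := by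
  refine ⟨isHomogeneous_sectionPoly k c, fun z ↦ ?_⟩
  rw [aeval_sectionPoly, Finset.sum_range_succ', hc, map_zero, zero_mul, zero_mul, add_zero,
    basisComb]
  rw [show ((∑ l ∈ Finset.Icc 1 k, (c l : ℂ) • basisForm k l :
    CuspForm 𝒮ℒ ((12 * k : ℕ) : ℤ)) : ℍ → ℂ) z =
    ∑ l ∈ Finset.Icc 1 k, (c l : ℂ) * basisForm k l z by simp]
  rw [Finset.sum_Icc_one_eq_sum_range]
  refine Finset.sum_congr rfl fun l hl ↦ ?_
  rw [Finset.mem_range] at hl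
  rw [basisForm_apply (by omega) (by omega)]
  simp [kleinJ_mul_discriminant, pow_mul, mul_assoc]

/-- The difference of two sections may a priori contain Z₀^k. Multiplication by Δ moves to weight
12(k + 1), where all k + 1 monomials become basis forms with index raised by one, and independence
applies. Hence the choice made in `sectionOf` is harmless. -/
theorem IsSectionOf.unique {k : ℕ} {f : CuspForm 𝒮ℒ ((12 * k : ℕ) : ℤ)}
    {F G : MvPolynomial (Fin 2) ℚ} (hF : IsSectionOf k f F) (hG : IsSectionOf k f G) : F = G := by
  rw [← sub_eq_zero]
  obtain ⟨c, hc⟩ := exists_eq_sectionPoly (hF.1.sub hG.1)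
  have h0 : basisComb (k + 1) (fun l ↦ (c (l - 1) : ℂ)) = 0 := by
    ext z
    have h : MvPolynomial.aeval ![kleinJ z * ModularForm.discriminant z,
        ModularForm.discriminant z] (F - G) = 0 := by
      rw [map_sub, ← hF.2, ← hG.2, sub_self]
    rw [hc, aeval_sectionPoly] at h
    have e : (basisComb (k + 1) (fun l ↦ (c (l - 1) : ℂ)) : ℍ → ℂ) z =
        ∑ l ∈ Finset.Icc 1 (k + 1), (c (l - 1) : ℂ) * basisForm (k + 1) l z := by
      simp [basisComb]
    rw [e, Finset.sum_Icc_one_eq_sum_range]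
    rw [show (0 : CuspForm 𝒮ℒ ((12 * (k + 1) : ℕ) : ℤ)) z = ModularForm.discriminant z * 0 by simp,
      ← h, Finset.mul_sum]
    refine Finset.sum_congr rfl fun l hl ↦ ?_
    rw [Finset.mem_range] at hl
    rw [basisForm_apply (by omega) (by omega)]
    simp [kleinJ_mul_discriminant, pow_mul, pow_succ]
    ring
  have h1 := basisComb_eq_zero h0
  rw [hc, sectionPoly]
  refine Finset.sum_eq_zero fun l hl ↦ ?_
  rw [Finset.mem_range] at hl
  have := h1 (l + 1) (Finset.mem_Icc.2 ⟨by omega, by omega⟩)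
  rw [Nat.add_sub_cancel] at this
  rw [show c l = 0 by exact_mod_cast this, map_zero, zero_mul, zero_mul]

theorem IsSectionOf.sectionOf_eq {k : ℕ} {f : CuspForm 𝒮ℒ ((12 * k : ℕ) : ℤ)}
    {F : MvPolynomial (Fin 2) ℚ} (hF : IsSectionOf k f F) : sectionOf k f = F := by
  have h : ∃ F, IsSectionOf k f F := ⟨F, hF⟩
  rw [sectionOf, dif_pos h]
  exact h.choose_spec.unique hF

theorem IsSectionOf.smul {k : ℕ} {f : CuspForm 𝒮ℒ ((12 * k : ℕ) : ℤ)}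
    {F : MvPolynomial (Fin 2) ℚ} (hF : IsSectionOf k f F) (a : ℚ) :
    IsSectionOf k (a • f) (a • F) := by
  refine ⟨?_, fun z ↦ ?_⟩
  · rw [MvPolynomial.smul_eq_C_mul]
    simpa using (MvPolynomial.isHomogeneous_C (Fin 2) a).mul hF.1
  · rw [map_smul, ← hF.2]
    rfl

theorem rat_smul_eq {w : ℤ} (a : ℚ) (f : CuspForm 𝒮ℒ w) : a • f = (a : ℂ) • f := by
  ext z
  change a • f z = (a : ℂ) • f z
  rw [Rat.smul_def, smul_eq_mul]

theorem peterssonNorm_smul (k : ℕ) (a : ℚ) (f : CuspForm 𝒮ℒ ((12 * k : ℕ) : ℤ)) :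
    peterssonNorm k (a • f) = |(a : ℝ)| * peterssonNorm k f := by
  rw [peterssonNorm, peterssonNorm, ← Real.sqrt_sq (abs_nonneg (a : ℝ)),
    ← Real.sqrt_mul (by positivity), ← integral_const_mul, rat_smul_eq]
  congr 2
  ext z
  rw [show ((a : ℂ) • f) z = (a : ℂ) * f z from rfl, norm_mul, mul_pow, mul_assoc,
    Complex.norm_ratCast]

/-! ### Primitive integral forms and their height -/

/-- Primitive integral coefficient vectors, with the convention that the constant term vanishes. -/
structure IsPrimitiveVec (k : ℕ) (c : ℕ → ℤ) : Prop where
  zero : c 0 = 0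
  gcd_eq_one : (Finset.Icc 1 k).gcd c = 1

/-- The cusp form with integral coordinates `c`. -/
def intComb (k : ℕ) (c : ℕ → ℤ) : CuspForm 𝒮ℒ ((12 * k : ℕ) : ℤ) :=
  basisComb k fun l ↦ (c l : ℂ)

theorem IsPrimitiveVec.exists_not_dvd {k : ℕ} {c : ℕ → ℤ} (hc : IsPrimitiveVec k c) {p : ℕ}
    (hp : p.Prime) : ∃ l ≤ k, ¬ (p : ℤ) ∣ c l := by
  by_contra! h
  have : (p : ℤ) ∣ (Finset.Icc 1 k).gcd c :=
    Finset.dvd_gcd fun l hl ↦ h l (Finset.mem_Icc.1 hl).2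
  rw [hc.gcd_eq_one] at this
  exact (Nat.prime_iff_prime_int.1 hp).not_dvd_one this

/-- Gauss's lemma reduces the finite norms to |a|_p, and the product formula cancels these against
the factor |a| in the Petersson norm. -/
theorem logHeight_smul_intComb {k : ℕ} {c : ℕ → ℤ} (hc : IsPrimitiveVec k c) {a : ℚ} (ha : a ≠ 0)
    (hpos : 0 < peterssonNorm k (intComb k c)) :
    logHeight k (a • intComb k c) = -Real.log (peterssonNorm k (intComb k c)) := by
  have hs : IsSectionOf k (intComb k c) (sectionPoly k fun l ↦ (c l : ℚ)) := by
    have := isSectionOf_sectionPoly (k := k) (c := fun l ↦ (c l : ℚ)) (by simp [hc.zero])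
    simpa [intComb] using this
  have hfin : ∀ p : Nat.Primes, finiteNorm p k (a • intComb k c) = padicNorm p a := by
    intro p
    have : Fact (p : ℕ).Prime := ⟨p.2⟩
    obtain ⟨l, hl, hdvd⟩ := hc.exists_not_dvd p.2
    rw [finiteNorm, (hs.smul a).sectionOf_eq, padicSupNorm_smul,
      padicSupNorm_sectionPoly_eq_one _ hl hdvd, mul_one]
  rw [logHeight, finsum_congr fun p ↦ congrArg Real.log (hfin p), finsum_log_padicNorm ha,
    peterssonNorm_smul, Real.log_mul (abs_ne_zero.2 (by exact_mod_cast ha)) hpos.ne']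
  ring

theorem intComb_mem (k : ℕ) (c : ℕ → ℤ) : intComb k c ∈ cuspFormsInt k := by
  intro n
  have : qCoeff n (intComb k c) ∈ (Int.castRingHom ℂ).range := by
    rw [intComb, qCoeff_basisComb]
    exact Subring.sum_mem _ fun l _ ↦ Subring.mul_mem _ ⟨c l, rfl⟩ (qCoeff_basisForm_mem _ _ _ _)
  obtain ⟨a, ha⟩ := this
  exact ⟨a, ha.symm⟩

theorem cuspFormsInt_le {k : ℕ} {f : CuspForm 𝒮ℒ ((12 * k : ℕ) : ℤ)} (hf : f ∈ cuspFormsInt k) :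
    f ∈ cuspFormsRat k := by
  intro n
  obtain ⟨a, ha⟩ := hf n
  exact ⟨a, by rw [ha]; norm_cast⟩

theorem IsPrimitiveVec.one_le {k : ℕ} {c : ℕ → ℤ} (hc : IsPrimitiveVec k c) : 1 ≤ k := by
  by_contra! h
  have := hc.gcd_eq_one
  rw [Finset.Icc_eq_empty (by omega), Finset.gcd_empty] at this
  exact zero_ne_one this

theorem IsPrimitiveVec.exists_ne_zero {k : ℕ} {c : ℕ → ℤ} (hc : IsPrimitiveVec k c) :
    ∃ l ∈ Finset.Icc 1 k, c l ≠ 0 := by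
  by_contra! h
  have := hc.gcd_eq_one
  rw [Finset.gcd_eq_zero_iff.2 h] at this
  exact zero_ne_one this

theorem exists_intComb_of_mem_cuspFormsInt {k : ℕ} {f : CuspForm 𝒮ℒ ((12 * k : ℕ) : ℤ)}
    (hf : f ∈ cuspFormsInt k) : ∃ c : ℕ → ℤ, f = intComb k c := by
  obtain ⟨c, hc, rfl⟩ := exists_basisComb_eq (Int.castRingHom ℂ).range (f := f) fun n ↦ by
    obtain ⟨a, ha⟩ := hf n
    exact ⟨a, ha.symm⟩
  choose d hd using hc
  exact ⟨d, by rw [intComb]; congr 1; ext l; exact (hd l).symm⟩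

/-- Every nonzero cusp form with rational `q`-expansion is a rational multiple of a primitive
integral one. -/
theorem exists_eq_smul_intComb {k : ℕ} {f : CuspForm 𝒮ℒ ((12 * k : ℕ) : ℤ)}
    (hf : f ∈ cuspFormsRat k) (h0 : f ≠ 0) :
    ∃ (a : ℚ) (c : ℕ → ℤ), a ≠ 0 ∧ IsPrimitiveVec k c ∧ f = a • intComb k c := by
  obtain ⟨d, hd, rfl⟩ := exists_basisComb_eq (Rat.castHom ℂ).range (f := f) fun n ↦ by
    obtain ⟨a, ha⟩ := hf n
    exact ⟨a, ha.symm⟩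
  choose q hq using hd
  -- `N` is a common denominator of the coordinates; with `g` the gcd of the cleared numerators, the
  -- scalar will be g / N.
  obtain ⟨N, hN⟩ := IsLocalization.exist_integer_multiples_of_finset (nonZeroDivisors ℤ)
    ((Finset.Icc 1 k).image q)
  have hN0 : ((N : ℤ) : ℚ) ≠ 0 := by exact_mod_cast nonZeroDivisors.ne_zero N.2
  have hN' : ∀ l ∈ Finset.Icc 1 k, ∃ m : ℤ, (m : ℚ) = (N : ℤ) * q l := fun l hl ↦ by
    obtain ⟨m, hm⟩ := hN _ (Finset.mem_image_of_mem q hl)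
    exact ⟨m, by simpa using hm⟩
  choose! m hm using hN'
  have hk : (Finset.Icc 1 k).Nonempty := by
    rw [Finset.nonempty_Icc]
    by_contra! h
    apply h0
    rw [basisComb, Finset.Icc_eq_empty (by omega), Finset.sum_empty]
  obtain ⟨c, hc, hc1⟩ := Finset.extract_gcd m hk
  set g := (Finset.Icc 1 k).gcd m
  have hql : ∀ l ∈ Finset.Icc 1 k, q l = (g / (N : ℤ) : ℚ) * c l := fun l hl ↦ by
    have h1 := hm l hl
    rw [hc l hl] at h1
    push_cast at h1
    field_simp
    linarith
  -- Index 0 lies outside the basis range, so the value there can be reset to 0 as primitivity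
  -- demands.
  have hc' : ∀ l ∈ Finset.Icc 1 k, (if l = 0 then 0 else c l) = c l := fun l hl ↦ by
    rw [if_neg]; have := (Finset.mem_Icc.1 hl).1; omega
  have hfeq : basisComb k d = (g / (N : ℤ) : ℚ) • intComb k (fun l ↦ if l = 0 then 0 else c l) := by
    rw [rat_smul_eq, intComb, basisComb, basisComb, Finset.smul_sum]
    refine Finset.sum_congr rfl fun l hl ↦ ?_
    simp only [hc' l hl]
    rw [smul_smul, ← hq l, hql l hl]
    push_cast
    simp
  refine ⟨g / (N : ℤ), fun l ↦ if l = 0 then 0 else c l, ?_, ⟨if_pos rfl, ?_⟩, hfeq⟩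
  · intro h
    apply h0
    rw [hfeq, h, zero_smul]
  · rw [← hc1]
    exact Finset.gcd_congr rfl hc'

/-! ### Integration over rectangles in the upper half-plane -/

/-- The integral of a function over a product set in the upper half-plane. -/
theorem UpperHalfPlane.setLIntegral_reProdIm {G : ℂ → ENNReal} (hG : Measurable G) {A B : Set ℝ}
    (hA : MeasurableSet A) (hB : MeasurableSet B) (hB0 : ∀ y ∈ B, 0 < y) :
    ∫⁻ z : ℍ in {z | z.re ∈ A ∧ z.im ∈ B}, G z =
      ∫⁻ y in B, ∫⁻ x in A, G (x + y * Complex.I) * ENNReal.ofReal (1 / y ^ 2) := by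
  have hS : MeasurableSet {z : ℍ | z.re ∈ A ∧ z.im ∈ B} :=
    (UpperHalfPlane.continuous_re.measurable hA).inter (UpperHalfPlane.continuous_im.measurable hB)
  have hd : Measurable fun z : ℍ ↦ (((1 / NNReal.mk z.im z.im_pos.le) ^ 2 : NNReal) : ENNReal) := by
    have : Continuous fun z : ℍ ↦ (1 / NNReal.mk z.im z.im_pos.le : NNReal) ^ 2 := by
      refine .pow (.div₀ continuous_const ?_ ?_) _
      · exact continuous_im.subtype_mk _
      · exact fun x ↦ NNReal.ne_iff.mp x.im_ne_zero
    exact this.measurable.coe_nnreal_ennreal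
  have hmp : MeasurePreserving UpperHalfPlane.coe (volume.comap UpperHalfPlane.coe)
      (volume.restrict (.range UpperHalfPlane.coe)) :=
    ⟨measurable_coe, by rw [measurableEmbedding_coe.map_comap]⟩
  -- The hyperbolic measure has density 1/y² against Lebesgue measure; the integral is transported
  -- to ℂ, then to ℝ × ℝ, and Tonelli applies.
  rw [volume_def, setLIntegral_withDensity_eq_setLIntegral_mul _ hd
    (show Measurable fun z : ℍ ↦ G z from hG.comp measurable_coe) hS]
  have e1 : ∀ z : ℍ, ((fun z : ℍ ↦ (((1 / NNReal.mk z.im z.im_pos.le) ^ 2 : NNReal) : ENNReal)) *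
      fun z : ℍ ↦ G z) z = (fun w : ℂ ↦ G w * ENNReal.ofReal (1 / w.im ^ 2)) z := by
    intro z
    simp only [Pi.mul_apply]
    rw [mul_comm]
    congr 1
    rw [ENNReal.ofReal, ENNReal.coe_inj, ← NNReal.coe_inj, Real.coe_toNNReal _ (by positivity)]
    simp
  rw [setLIntegral_congr_fun hS fun z _ ↦ e1 z,
    hmp.setLIntegral_comp_emb measurableEmbedding_coe
      (fun w : ℂ ↦ G w * ENNReal.ofReal (1 / w.im ^ 2)),
    Measure.restrict_restrict' measurableEmbedding_coe.measurableSet_range,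
    Set.inter_eq_self_of_subset_left (Set.image_subset_range _ _)]
  have e2 : UpperHalfPlane.coe '' {z : ℍ | z.re ∈ A ∧ z.im ∈ B} =
      Complex.measurableEquivRealProd ⁻¹' (A ×ˢ B) := by
    ext w
    simp only [Set.mem_image, Set.mem_ofPred_eq, Set.mem_preimage, Set.mem_prod,
      Complex.measurableEquivRealProd_apply]
    constructor
    · rintro ⟨z, hz, rfl⟩
      exact hz
    · rintro ⟨h1, h2⟩
      exact ⟨⟨w, hB0 _ h2⟩, ⟨h1, h2⟩, rfl⟩
  have hmp2 := Complex.volume_preserving_equiv_real_prod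
  have e3 : ∀ w : ℂ, G w * ENNReal.ofReal (1 / w.im ^ 2) =
      (fun q : ℝ × ℝ ↦ G (q.1 + q.2 * Complex.I) * ENNReal.ofReal (1 / q.2 ^ 2))
        (Complex.measurableEquivRealProd w) := by
    intro w
    simp [Complex.measurableEquivRealProd_apply, Complex.re_add_im]
  have hQ : Measurable fun q : ℝ × ℝ ↦
      G (q.1 + q.2 * Complex.I) * ENNReal.ofReal (1 / q.2 ^ 2) := by fun_prop
  rw [e2, lintegral_congr e3]
  refine (hmp2.setLIntegral_comp_preimage (hA.prod hB) hQ).trans ?_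
  rw [Measure.volume_eq_prod, ← Measure.prod_restrict, lintegral_prod_symm]
  exact hQ.aemeasurable

/-! ### Finite area of the fundamental domain and integrability -/

theorem one_half_lt_im_of_mem_fd {z : ℍ} (hz : z ∈ 𝒟) : 1 / 2 < z.im := by
  have h1 : 1 ≤ z.re * z.re + z.im * z.im := by
    have := hz.1
    rwa [Complex.normSq_apply] at this
  have h2 := abs_le.1 hz.2
  have := z.im_pos
  nlinarith [h2.1, h2.2]

theorem measurableSet_fd : MeasurableSet (𝒟 : Set ℍ) := by
  apply MeasurableSet.inter
  · exact measurableSet_le measurable_const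
      (Complex.continuous_normSq.measurable.comp UpperHalfPlane.measurable_coe)
  · exact measurableSet_le (UpperHalfPlane.continuous_re.measurable.norm) measurable_const

/-- The standard fundamental domain has finite hyperbolic area. -/
theorem volume_fd_lt_top : volume (𝒟 : Set ℍ) < ⊤ := by
  have hsub : (𝒟 : Set ℍ) ⊆ {z | z.re ∈ Set.Icc (-(1 / 2)) (1 / 2) ∧ z.im ∈ Set.Ioi (1 / 2)} :=
    fun z hz ↦ ⟨⟨(abs_le.1 hz.2).1, (abs_le.1 hz.2).2⟩, one_half_lt_im_of_mem_fd hz⟩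
  refine lt_of_le_of_lt (measure_mono hsub) ?_
  have h := UpperHalfPlane.setLIntegral_reProdIm (G := fun _ ↦ 1) measurable_const
    (A := Set.Icc (-(1 / 2)) (1 / 2)) (B := Set.Ioi (1 / 2)) measurableSet_Icc measurableSet_Ioi
    (fun y hy ↦ lt_trans (by norm_num) hy)
  rw [setLIntegral_one] at h
  rw [h]
  simp only [one_mul, lintegral_const, Measure.restrict_apply_univ, Real.volume_Icc]
  norm_num
  have hi : IntegrableOn (fun y : ℝ ↦ y ^ (-2 : ℝ)) (Set.Ioi (1 / 2)) :=
    integrableOn_Ioi_rpow_of_lt (by norm_num) (by norm_num)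
  have := hi.lintegral_lt_top
  refine lt_of_le_of_lt (le_of_eq ?_) this
  refine setLIntegral_congr_fun measurableSet_Ioi fun y hy ↦ ?_
  have : (0 : ℝ) < y := lt_trans (by norm_num) hy
  rw [Real.rpow_neg this.le]
  norm_cast

theorem continuous_peterssonIntegrand {k : ℕ} (f : CuspForm 𝒮ℒ ((12 * k : ℕ) : ℤ)) :
    Continuous fun z : ℍ ↦ ‖f z‖ ^ 2 * (4 * Real.pi * z.im) ^ (12 * k) := by
  have h1 : Continuous f := (CuspFormClass.holo f).continuous
  have h2 := UpperHalfPlane.continuous_im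
  fun_prop

/-- The Petersson function of a cusp form is bounded and the domain has finite area. -/
theorem integrableOn_peterssonIntegrand {k : ℕ} (f : CuspForm 𝒮ℒ ((12 * k : ℕ) : ℤ)) :
    IntegrableOn (fun z : ℍ ↦ ‖f z‖ ^ 2 * (4 * Real.pi * z.im) ^ (12 * k)) 𝒟 := by
  obtain ⟨C, hC⟩ := CuspFormClass.petersson_bounded_left ((12 * k : ℕ) : ℤ) 𝒮ℒ f f
  refine Measure.integrableOn_of_bounded (M := (4 * Real.pi) ^ (12 * k) * C)
    volume_fd_lt_top.ne (continuous_peterssonIntegrand f).aestronglyMeasurable ?_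
  refine Eventually.of_forall fun z ↦ ?_
  have h := hC z
  have hz := z.im_pos
  rw [petersson, norm_mul, norm_mul, Complex.norm_conj, ← sq, norm_zpow, Complex.norm_real,
    Real.norm_of_nonneg hz.le, zpow_natCast] at h
  rw [Real.norm_of_nonneg (by positivity), mul_pow, mul_left_comm]
  gcongr

/-! ### Lower bounds for the Petersson norm -/

/-- Cauchy–Schwarz on an interval of length 1, by integrating (t - u)² ≥ 0 with t the mean of u. -/
theorem sq_integral_le_integral_sq {u : ℝ → ℝ} (hu : Continuous u) (a : ℝ) :
    (∫ x in a..a + 1, u x) ^ 2 ≤ ∫ x in a..a + 1, u x ^ 2 := by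
  set t := ∫ x in a..a + 1, u x with ht
  have h : ∫ x in a..a + 1, (2 * t * u x - t ^ 2) ≤ ∫ x in a..a + 1, u x ^ 2 := by
    apply intervalIntegral.integral_mono_on (by linarith)
    · exact (by fun_prop : Continuous fun x ↦ 2 * t * u x - t ^ 2).intervalIntegrable _ _
    · exact (by fun_prop : Continuous fun x ↦ u x ^ 2).intervalIntegrable _ _
    · intro x _
      nlinarith [sq_nonneg (t - u x)]
  rw [intervalIntegral.integral_sub, intervalIntegral.integral_const_mul,
    intervalIntegral.integral_const, ← ht] at h
  · simp only [add_sub_cancel_left, one_smul] at h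
    nlinarith
  · exact (by fun_prop : Continuous fun x ↦ 2 * t * u x).intervalIntegrable _ _
  · exact continuous_const.intervalIntegrable _ _

theorem continuous_horizontal {w : ℤ} (f : CuspForm 𝒮ℒ w) {y : ℝ} (hy : 0 < y) :
    Continuous fun x : ℝ ↦ f (UpperHalfPlane.ofComplex (x + y * Complex.I)) := by
  have h : Continuous fun x : ℝ ↦ (⟨x + y * Complex.I, by simpa using hy⟩ : ℍ) := by
    rw [UpperHalfPlane.isEmbedding_coe.continuous_iff]
    change Continuous fun x : ℝ ↦ (x + y * Complex.I : ℂ)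
    fun_prop
  have h1 : Continuous f := (CuspFormClass.holo f).continuous
  refine (h1.comp h).congr fun x ↦ ?_
  rw [UpperHalfPlane.ofComplex_apply_of_im_pos (by simpa using hy)]
  rfl

/-- The coefficient bound `|a_n|² e ^ (- 4 π n y) ≤ ∫ |f(x + i y)|² dx`. -/
theorem norm_qCoeff_sq_le_integral {w : ℤ} (f : CuspForm 𝒮ℒ w) (n : ℕ) {y : ℝ} (hy : 0 < y) :
    ‖qCoeff n f‖ ^ 2 * Real.exp (-(4 * Real.pi * n * y)) ≤
      ∫ x in (-(1 / 2) : ℝ)..1 / 2, ‖f (UpperHalfPlane.ofComplex (x + y * Complex.I))‖ ^ 2 := by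
  have hper : Function.Periodic (f ∘ UpperHalfPlane.ofComplex) ((1 : ℝ) : ℂ) :=
    SlashInvariantFormClass.periodic_comp_ofComplex f one_mem_strictPeriods_SL
  have hc := continuous_horizontal f hy
  -- The fundamental domain uses [-1/2, 1/2] and the coefficient formula [0, 1]; periodicity
  -- reconciles them.
  have hshift : ∫ x in (-(1 / 2) : ℝ)..1 / 2,
      ‖f (UpperHalfPlane.ofComplex (x + y * Complex.I))‖ ^ 2 =
      ∫ x in (0 : ℝ)..0 + 1, ‖f (UpperHalfPlane.ofComplex (x + y * Complex.I))‖ ^ 2 := by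
    have hp : Function.Periodic
        (fun x : ℝ ↦ ‖f (UpperHalfPlane.ofComplex (x + y * Complex.I))‖ ^ 2) 1 := by
      intro x
      have := hper (x + y * Complex.I)
      simp only [Function.comp_apply] at this
      simp only
      rw [← this]
      push_cast
      ring_nf
    rw [show (1 / 2 : ℝ) = -(1 / 2) + 1 by norm_num]
    rw [show (-(-(1 / 2) + 1) : ℝ) = -(1 / 2) by norm_num]
    exact hp.intervalIntegral_add_eq _ _
  -- The L¹ bound comes from the integral formula for the coefficient; Cauchy–Schwarz then turns it
  -- into the L² bound.
  have hmain : ‖qCoeff n f‖ * Real.exp (-(2 * Real.pi * n * y)) ≤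
      ∫ x in (0 : ℝ)..0 + 1, ‖f (UpperHalfPlane.ofComplex (x + y * Complex.I))‖ := by
    have h := UpperHalfPlane.qExpansion_coeff_eq_intervalIntegral (f := f) one_pos hper
      (CuspFormClass.holo f) (CuspFormClass.zero_at_infty f).isBoundedAtImInfty n hy
    rw [qCoeff_apply, h, norm_mul]
    have hb : ‖∫ u in (0 : ℝ)..1, 1 / Function.Periodic.qParam 1 (u + y * Complex.I) ^ n *
        f ⟨u + y * Complex.I, by simpa using hy⟩‖ ≤
        ∫ u in (0 : ℝ)..1, Real.exp (2 * Real.pi * n * y) *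
          ‖f (UpperHalfPlane.ofComplex (u + y * Complex.I))‖ := by
      apply intervalIntegral.norm_integral_le_of_norm_le zero_le_one
      · refine Eventually.of_forall fun u _ ↦ ?_
        rw [norm_mul, norm_div, norm_one, norm_pow, Function.Periodic.norm_qParam]
        apply le_of_eq
        congr 1
        · simp only [Complex.add_im, Complex.ofReal_im, Complex.mul_im, Complex.ofReal_re,
            Complex.I_im, Complex.I_re]
          rw [← Real.exp_nat_mul, one_div, ← Real.exp_neg]
          congr 1
          ring
        · rw [UpperHalfPlane.ofComplex_apply_of_im_pos (by simpa using hy)]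
      · exact (continuous_const.mul hc.norm).intervalIntegrable _ _
    rw [intervalIntegral.integral_const_mul] at hb
    rw [zero_add]
    have e : Real.exp (2 * Real.pi * n * y) * Real.exp (-(2 * Real.pi * n * y)) = 1 := by
      rw [← Real.exp_add, add_neg_cancel, Real.exp_zero]
    calc _ ≤ (Real.exp (2 * Real.pi * n * y) *
          ∫ u in (0 : ℝ)..1, ‖f (UpperHalfPlane.ofComplex (u + y * Complex.I))‖) *
          Real.exp (-(2 * Real.pi * n * y)) := by
          refine mul_le_mul_of_nonneg_right ?_ (Real.exp_pos _).le
          simpa using hb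
      _ = _ := by rw [mul_right_comm, e, one_mul]
  rw [hshift]
  refine le_trans ?_ (sq_integral_le_integral_sq hc.norm 0)
  calc _ = (‖qCoeff n f‖ * Real.exp (-(2 * Real.pi * n * y))) ^ 2 := by
        rw [mul_pow, ← Real.exp_nat_mul]
        congr 2
        push_cast
        ring
    _ ≤ _ := by gcongr

theorem peterssonNorm_sq (k : ℕ) (f : CuspForm 𝒮ℒ ((12 * k : ℕ) : ℤ)) :
    peterssonNorm k f ^ 2 = ∫ z in 𝒟, ‖f z‖ ^ 2 * (4 * Real.pi * z.im) ^ (12 * k) :=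
  Real.sq_sqrt (setIntegral_nonneg measurableSet_fd fun z _ ↦ by
    have := z.im_pos
    positivity)

/-- A lower bound for the Petersson norm in terms of the `n`-th coefficient, by integrating over
the rectangle `|x| ≤ 1 / 2`, `Y ≤ y ≤ Y'`. -/
theorem le_peterssonNorm_sq {k : ℕ} (f : CuspForm 𝒮ℒ ((12 * k : ℕ) : ℤ)) (n : ℕ) {Y Y' : ℝ}
    (hY : 1 ≤ Y) :
    ‖qCoeff n f‖ ^ 2 * Real.exp (-(4 * Real.pi * n * Y')) * (4 * Real.pi * Y) ^ (12 * k) *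
      ((Y' - Y) / Y' ^ 2) ≤ peterssonNorm k f ^ 2 := by
  rw [peterssonNorm_sq]
  have hnn : ∀ z : ℍ, 0 ≤ ‖f z‖ ^ 2 * (4 * Real.pi * z.im) ^ (12 * k) := fun z ↦ by
    have := z.im_pos
    positivity
  rw [← ENNReal.ofReal_le_ofReal_iff (integral_nonneg hnn),
    ofReal_integral_eq_lintegral_ofReal (integrableOn_peterssonIntegrand f)
      (Eventually.of_forall hnn)]
  -- The rectangle formula integrates a measurable function on ℂ, so the integrand is extended from
  -- ℍ.
  obtain ⟨G, hG, hGf⟩ := measurableEmbedding_coe.exists_measurable_extend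
    (g := fun z : ℍ ↦ ENNReal.ofReal (‖f z‖ ^ 2 * (4 * Real.pi * z.im) ^ (12 * k)))
    (continuous_peterssonIntegrand f).measurable.ennreal_ofReal (fun _ ↦ inferInstance)
  have hGf' : ∀ z : ℍ, ENNReal.ofReal (‖f z‖ ^ 2 * (4 * Real.pi * z.im) ^ (12 * k)) = G z :=
    fun z ↦ (congrFun hGf z).symm
  -- Since `Y ≥ 1`, the rectangle lies above the unit circle.
  have hsub : {z : ℍ | z.re ∈ Set.Icc (-(1 / 2)) (1 / 2) ∧ z.im ∈ Set.Icc Y Y'} ⊆ 𝒟 := by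
    rintro z ⟨h1, h2⟩
    refine ⟨?_, abs_le.2 h1⟩
    rw [Complex.normSq_apply]
    change 1 ≤ z.re * z.re + z.im * z.im
    nlinarith [h2.1, mul_self_nonneg z.re]
  refine le_trans ?_ (lintegral_mono_set hsub)
  rw [lintegral_congr hGf', UpperHalfPlane.setLIntegral_reProdIm hG measurableSet_Icc
    measurableSet_Icc (fun y hy ↦ by linarith [hy.1])]
  -- Each factor is replaced by its minimum on the strip: the exponential and 1/y² at `Y'`, the
  -- power at `Y`.
  have hinner : ∀ y ∈ Set.Icc Y Y',
      ENNReal.ofReal (‖qCoeff n f‖ ^ 2 * Real.exp (-(4 * Real.pi * n * Y')) *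
        (4 * Real.pi * Y) ^ (12 * k) * (1 / Y' ^ 2)) ≤
      ∫⁻ x : ℝ in Set.Icc (-(1 / 2)) (1 / 2), G (x + y * Complex.I) * ENNReal.ofReal (1 / y ^ 2) := by
    intro y hy
    have hy0 : 0 < y := by linarith [hy.1]
    have hc := continuous_horizontal f hy0
    have e : ∀ x : ℝ, G (x + y * Complex.I) * ENNReal.ofReal (1 / y ^ 2) =
        ENNReal.ofReal (‖f (UpperHalfPlane.ofComplex (x + y * Complex.I))‖ ^ 2 *
          ((4 * Real.pi * y) ^ (12 * k) * (1 / y ^ 2))) := by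
      intro x
      have h := hGf' ⟨x + y * Complex.I, by simpa using hy0⟩
      rw [show G (x + y * Complex.I) = G ((⟨x + y * Complex.I, by simpa using hy0⟩ : ℍ) : ℂ)
        from rfl, ← h, ← ENNReal.ofReal_mul (hnn _), mul_assoc,
        UpperHalfPlane.ofComplex_apply_of_im_pos (by simpa using hy0)]
      congr 4
      simp [UpperHalfPlane.im]
    have hi : IntegrableOn (fun x : ℝ ↦ ‖f (UpperHalfPlane.ofComplex (x + y * Complex.I))‖ ^ 2 *
          ((4 * Real.pi * y) ^ (12 * k) * (1 / y ^ 2))) (Set.Icc (-(1 / 2)) (1 / 2)) :=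
      ((hc.norm.pow 2).mul continuous_const).integrableOn_Icc
    rw [lintegral_congr e, ← ofReal_integral_eq_lintegral_ofReal hi
      (Eventually.of_forall fun x ↦ by positivity)]
    apply ENNReal.ofReal_le_ofReal
    rw [integral_mul_const, integral_Icc_eq_integral_Ioc,
      ← intervalIntegral.integral_of_le (by norm_num)]
    have hq := norm_qCoeff_sq_le_integral f n hy0
    rw [mul_assoc]
    have hY0 : 0 < Y := by linarith
    refine mul_le_mul (le_trans ?_ hq) ?_ (by positivity) (le_trans (by positivity) hq)
    · gcongr
      exact hy.2
    · gcongr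
      exacts [hy.1, hy.2]
  calc _ = ∫⁻ y in Set.Icc Y Y', ENNReal.ofReal (‖qCoeff n f‖ ^ 2 *
        Real.exp (-(4 * Real.pi * n * Y')) * (4 * Real.pi * Y) ^ (12 * k) * (1 / Y' ^ 2)) := by
        rw [setLIntegral_const, Real.volume_Icc, ← ENNReal.ofReal_mul (by positivity)]
        congr 1
        ring
    _ ≤ _ := setLIntegral_mono' measurableSet_Icc hinner

/-! ### The order at the cusp -/

theorem ordInfty_eq {w : ℤ} {f : CuspForm 𝒮ℒ w} {m : ℕ} (hm : qCoeff m f ≠ 0)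
    (h : ∀ n < m, qCoeff n f = 0) : ordInfty f = m := by
  rw [ordInfty, PowerSeries.order_eq_nat.2 ⟨hm, h⟩]
  rfl

theorem exists_qCoeff_ne_zero {k : ℕ} {f : CuspForm 𝒮ℒ ((12 * k : ℕ) : ℤ)} (hf : f ≠ 0) :
    ∃ n, 1 ≤ n ∧ n ≤ k ∧ qCoeff n f ≠ 0 := by
  by_contra! h
  exact hf (CuspForm.eq_zero_of_qCoeff fun n hn ↦
    h n (Finset.mem_Icc.1 hn).1 (Finset.mem_Icc.1 hn).2)

theorem ordInfty_spec {k : ℕ} {f : CuspForm 𝒮ℒ ((12 * k : ℕ) : ℤ)} (hf : f ≠ 0) :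
    1 ≤ ordInfty f ∧ ordInfty f ≤ k ∧ qCoeff (ordInfty f) f ≠ 0 ∧
      ∀ n < ordInfty f, qCoeff n f = 0 := by
  classical
  obtain ⟨n, hn1, hnk, hn⟩ := exists_qCoeff_ne_zero hf
  have hex : ∃ n, qCoeff n f ≠ 0 := ⟨n, hn⟩
  have hlt : ∀ m < Nat.find hex, qCoeff m f = 0 := fun m hm ↦ not_not.1 (Nat.find_min hex hm)
  rw [ordInfty_eq (Nat.find_spec hex) hlt]
  refine ⟨?_, (Nat.find_min' hex hn).trans hnk, Nat.find_spec hex, hlt⟩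
  rw [Nat.one_le_iff_ne_zero]
  intro h0
  have := Nat.find_spec hex
  rw [h0] at this
  exact this (qCoeff_zero_eq_zero f)

theorem qCoeff_rat_smul {w : ℤ} (n : ℕ) (a : ℚ) (f : CuspForm 𝒮ℒ w) :
    qCoeff n (a • f) = a * qCoeff n f := by
  rw [rat_smul_eq, map_smul, smul_eq_mul]

theorem ordInfty_smul {k : ℕ} {f : CuspForm 𝒮ℒ ((12 * k : ℕ) : ℤ)} (hf : f ≠ 0) {a : ℚ}
    (ha : a ≠ 0) : ordInfty (a • f) = ordInfty f := by
  obtain ⟨-, -, h1, h2⟩ := ordInfty_spec hf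
  apply ordInfty_eq
  · rw [qCoeff_rat_smul]
    exact mul_ne_zero (by exact_mod_cast ha) h1
  · intro n hn
    rw [qCoeff_rat_smul, h2 n hn, mul_zero]

theorem IsPrimitiveVec.intComb_ne_zero {k : ℕ} {c : ℕ → ℤ} (hc : IsPrimitiveVec k c) :
    intComb k c ≠ 0 := by
  intro h
  obtain ⟨l, hl, hl0⟩ := hc.exists_ne_zero
  exact hl0 (by exact_mod_cast basisComb_eq_zero h l hl)

theorem exists_int_qCoeff_intComb (k : ℕ) (c : ℕ → ℤ) (n : ℕ) :
    ∃ a : ℤ, qCoeff n (intComb k c) = a := intComb_mem k c n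

/-- A nonzero integer has absolute value at least 1; this is where integrality enters the
archimedean estimate. -/
theorem one_le_norm_qCoeff_ordInfty {k : ℕ} {c : ℕ → ℤ} (hc : IsPrimitiveVec k c) :
    1 ≤ ‖qCoeff (ordInfty (intComb k c)) (intComb k c)‖ := by
  have h := (ordInfty_spec hc.intComb_ne_zero).2.2.1
  obtain ⟨a, ha⟩ := exists_int_qCoeff_intComb k c (ordInfty (intComb k c))
  rw [ha] at h ⊢
  rw [Complex.norm_intCast]
  exact_mod_cast Int.one_le_abs (by exact_mod_cast h)

/-- Positivity keeps `Real.log` away from its default value at 0. -/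
theorem peterssonNorm_pos {k : ℕ} {c : ℕ → ℤ} (hc : IsPrimitiveVec k c) :
    0 < peterssonNorm k (intComb k c) := by
  have h := le_peterssonNorm_sq (intComb k c) (ordInfty (intComb k c)) (Y := 1) (Y' := 2) le_rfl
  have h1 := one_le_norm_qCoeff_ordInfty hc
  have h2 : 0 < peterssonNorm k (intComb k c) ^ 2 := lt_of_lt_of_le (by positivity) h
  exact lt_of_le_of_ne (Real.sqrt_nonneg _) fun h0 ↦ by rw [← h0] at h2; simp at h2

theorem logHeight_eq_of_primitive {k : ℕ} {c : ℕ → ℤ} (hc : IsPrimitiveVec k c) {a : ℚ}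
    (ha : a ≠ 0) :
    logHeight k (a • intComb k c) = -Real.log (peterssonNorm k (intComb k c)) :=
  logHeight_smul_intComb hc ha (peterssonNorm_pos hc)

theorem logHeight_smul {k : ℕ} {f : CuspForm 𝒮ℒ ((12 * k : ℕ) : ℤ)} (hf : f ∈ cuspFormsRat k)
    (h0 : f ≠ 0) {a : ℚ} (ha : a ≠ 0) : logHeight k (a • f) = logHeight k f := by
  obtain ⟨b, c, hb, hc, rfl⟩ := exists_eq_smul_intComb hf h0
  rw [smul_smul, logHeight_eq_of_primitive hc (mul_ne_zero ha hb), logHeight_eq_of_primitive hc hb]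

/-! ### The upper bound for the height -/

/-- The error term in the upper bound for the normalized height. -/
def heightError (k : ℕ) : ℝ := (2 * Real.pi + (Real.log 9 + 3 * Real.log k) / 2) / k

theorem tendsto_heightError : Tendsto heightError atTop (𝓝 0) := by
  have h1 : Tendsto (fun k : ℕ ↦ (2 * Real.pi + Real.log 9 / 2) / (k : ℝ)) atTop (𝓝 0) :=
    tendsto_const_div_atTop_nhds_zero_nat _
  have h2 : Tendsto (fun k : ℕ ↦ 3 / 2 * (Real.log k ^ 1 / (1 * (k : ℝ) + 0))) atTop
      (𝓝 (3 / 2 * 0)) :=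
    ((Real.tendsto_pow_log_div_mul_add_atTop 1 0 1 one_ne_zero).comp
      tendsto_natCast_atTop_atTop).const_mul _
  have h := h1.add h2
  rw [mul_zero, add_zero] at h
  refine h.congr fun k ↦ ?_
  rw [heightError, pow_one, one_mul, add_zero]
  ring

/-- The central estimate: the rectangle bound for the leading coefficient, with the height of the
rectangle nearly optimal. -/
theorem neg_log_peterssonNorm_div_le {k : ℕ} {c : ℕ → ℤ} (hc : IsPrimitiveVec k c) :
    -Real.log (peterssonNorm k (intComb k c)) / k ≤
      ellBound ((ordInfty (intComb k c) : ℝ) / k) + heightError k := by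
  obtain ⟨hm1, hmk, -, -⟩ := ordInfty_spec hc.intComb_ne_zero
  have hcoeff := one_le_norm_qCoeff_ordInfty hc
  have hpos := peterssonNorm_pos hc
  have hk1 := hc.one_le
  set g := intComb k c
  set m := ordInfty g
  have hπ := Real.pi_gt_three
  have hπ0 := Real.pi_pos
  have hm : (1 : ℝ) ≤ m := by exact_mod_cast hm1
  have hm0 : (0 : ℝ) < m := by linarith
  have hk : (1 : ℝ) ≤ k := by exact_mod_cast hk1
  have hk0 : (0 : ℝ) < k := by linarith
  have hmk' : (m : ℝ) ≤ k := by exact_mod_cast hmk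
  -- 3k/(πm) maximizes e^(-4πmy)(4πy)^(12k). For m = k it is 3/π < 1, so 1 is added to stay in the
  -- fundamental domain; this costs e^(-4πm), the source of the term 2πc.
  set Y : ℝ := 3 * k / (Real.pi * m) + 1 with hY
  have hq : 3 * k / (Real.pi * m) ≤ k := by
    rw [div_le_iff₀ (by positivity)]
    have : 3 * 1 ≤ Real.pi * m := by gcongr
    nlinarith
  have hq0 : 0 < 3 * k / (Real.pi * m) := by positivity
  have hY1 : 1 ≤ Y := by linarith
  have h := le_peterssonNorm_sq g m (Y := Y) (Y' := Y + 1 / k) hY1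
  have hinv : 1 / (k : ℝ) ≤ 1 := by rw [div_le_one hk0]; exact hk
  have hinv0 : 0 < 1 / (k : ℝ) := by positivity
  -- Thickness 1/k adds only 4πm/k ≤ 4π to the exponent, and Y' ≤ k + 2 ≤ 3k gives the factor
  -- 1/(9k³). These two losses make up `heightError`.
  have hlow : Real.exp (-(12 * k + 4 * Real.pi * m + 4 * Real.pi)) * (12 * k / m) ^ (12 * k) *
      (1 / (9 * k ^ 3)) ≤ peterssonNorm k g ^ 2 := by
    refine le_trans ?_ h
    have hY' : Y + 1 / k ≤ 3 * k := by linarith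
    have hY'0 : 0 < Y + 1 / (k : ℝ) := by linarith
    refine mul_le_mul (mul_le_mul ?_ ?_ (by positivity) (by positivity)) ?_ (by positivity)
      (by positivity)
    · rw [← one_mul (Real.exp _)]
      refine mul_le_mul (one_le_pow₀ hcoeff) ?_ (Real.exp_pos _).le (by positivity)
      rw [Real.exp_le_exp, neg_le_neg_iff]
      have e : 4 * Real.pi * m * (Y + 1 / k) =
          12 * k + 4 * Real.pi * m + 4 * Real.pi * (m / k) := by
        rw [hY]
        field_simp
        ring
      rw [e]
      have : (m : ℝ) / k ≤ 1 := (div_le_one hk0).2 hmk'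
      nlinarith
    · gcongr
      calc (12 * k / m : ℝ) = 4 * Real.pi * (3 * k / (Real.pi * m)) := by field_simp; ring
        _ ≤ 4 * Real.pi * Y := by gcongr; linarith
    · rw [add_sub_cancel_left]
      calc (1 / (9 * k ^ 3) : ℝ) = 1 / k / (3 * k) ^ 2 := by field_simp; ring
        _ ≤ _ := by gcongr
  have hlog := Real.log_le_log (by positivity) hlow
  rw [Real.log_mul (by positivity) (by positivity), Real.log_mul (by positivity) (by positivity),
    Real.log_exp, Real.log_pow, Real.log_pow, one_div, Real.log_inv,
    Real.log_mul (by norm_num) (by positivity), Real.log_pow, Real.log_div (by positivity)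
    (by positivity), Real.log_mul (by norm_num) (by positivity)] at hlog
  push_cast at hlog
  rw [ellBound, heightError, Real.log_div (by positivity) (by positivity), div_le_iff₀ hk0]
  have e : (2 * Real.pi * (m / k) + 6 * (Real.log m - Real.log k + 1 - Real.log 12) +
      (2 * Real.pi + (Real.log 9 + 3 * Real.log k) / 2) / k) * k =
      2 * Real.pi * m + 6 * (Real.log m - Real.log k + 1 - Real.log 12) * k +
      (2 * Real.pi + (Real.log 9 + 3 * Real.log k) / 2) := by
    field_simp
  rw [e]
  linarith

/-- The uniform upper bound for the normalized logarithmic height. -/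
theorem logHeight_div_le {k : ℕ} {f : CuspForm 𝒮ℒ ((12 * k : ℕ) : ℤ)} (hf : f ∈ cuspFormsRat k)
    (h0 : f ≠ 0) : logHeight k f / k ≤ ellBound ((ordInfty f : ℝ) / k) + heightError k := by
  obtain ⟨b, c, hb, hc, rfl⟩ := exists_eq_smul_intComb hf h0
  rw [logHeight_eq_of_primitive hc hb, ordInfty_smul hc.intComb_ne_zero hb]
  exact neg_log_peterssonNorm_div_le hc

/-! ### Finiteness -/

theorem finite_int_norm_sq_le (B : ℝ) : {w : ℂ | (∃ a : ℤ, w = a) ∧ ‖w‖ ^ 2 ≤ B}.Finite := by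
  refine ((Set.finite_Icc (-(⌈B⌉₊ : ℤ)) ⌈B⌉₊).image fun a : ℤ ↦ (a : ℂ)).subset ?_
  rintro w ⟨⟨a, rfl⟩, hw⟩
  refine ⟨a, ?_, rfl⟩
  rw [Complex.norm_intCast, sq_abs] at hw
  have h1 : ((a ^ 2 : ℤ) : ℝ) ≤ ((⌈B⌉₊ : ℤ) : ℝ) := by
    push_cast
    exact hw.trans (Nat.le_ceil B)
  have h2 : a ^ 2 ≤ (⌈B⌉₊ : ℤ) := by exact_mod_cast h1
  constructor <;> nlinarith [sq_nonneg (a - 1), sq_nonneg (a + 1), sq_nonneg a,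
    Int.le_self_sq a, Int.le_self_sq (-a)]

/-- The primitive integral forms of height at least `r`. -/
def primitiveForms (k : ℕ) (r : ℝ) : Set (CuspForm 𝒮ℒ ((12 * k : ℕ) : ℤ)) :=
  {g | ∃ c, IsPrimitiveVec k c ∧ g = intComb k c ∧ r ≤ -Real.log (peterssonNorm k g)}

/-- There are only finitely many primitive integral forms of a given weight and of height bounded
below. -/
theorem finite_primitiveForms (k : ℕ) (r : ℝ) : (primitiveForms k r).Finite := by
  let K : ℕ → ℝ := fun n ↦
    Real.exp (-(4 * Real.pi * n * 2)) * (4 * Real.pi * 1) ^ (12 * k) * ((2 - 1) / 2 ^ 2)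
  have hK : ∀ n, 0 < K n := fun n ↦ by simp only [K]; have := Real.pi_pos; positivity
  -- The first k coefficients determine a form; they are integers, and the rectangle 1 ≤ y ≤ 2
  -- bounds each by the norm.
  let Φ : CuspForm 𝒮ℒ ((12 * k : ℕ) : ℤ) → (Finset.Icc 1 k → ℂ) := fun g n ↦ qCoeff n g
  have hΦ : Function.Injective Φ := fun f g h ↦
    CuspForm.eq_of_qCoeff fun n hn ↦ congrFun h ⟨n, hn⟩
  have hfin : (Set.univ.pi fun n : Finset.Icc 1 k ↦
      {w : ℂ | (∃ a : ℤ, w = a) ∧ ‖w‖ ^ 2 ≤ Real.exp (-r) ^ 2 / K n}).Finite :=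
    Set.Finite.pi fun n ↦ finite_int_norm_sq_le _
  refine (hfin.preimage hΦ.injOn).subset ?_
  rintro _ ⟨c, hc, rfl, hr⟩ n -
  refine ⟨exists_int_qCoeff_intComb k c n, ?_⟩
  rw [le_div_iff₀ (hK n)]
  have h := le_peterssonNorm_sq (intComb k c) n (Y := 1) (Y' := 2) le_rfl
  have hp := peterssonNorm_pos hc
  have hle : peterssonNorm k (intComb k c) ≤ Real.exp (-r) := by
    rw [← Real.log_le_iff_le_exp hp]
    linarith
  calc _ = _ := by simp only [Φ, K]; ring
    _ ≤ _ := h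
    _ ≤ _ := by gcongr

/-- Heights depend only on the primitive representative. This discreteness is why the successive
maxima are attained. -/
theorem finite_logHeight (k : ℕ) (r : ℝ) :
    {x | r ≤ x ∧ ∃ f ∈ cuspFormsRat k, f ≠ 0 ∧ logHeight k f = x}.Finite := by
  refine ((finite_primitiveForms k r).image fun g ↦ -Real.log (peterssonNorm k g)).subset ?_
  rintro x ⟨hr, f, hf, h0, rfl⟩
  obtain ⟨b, c, hb, hc, rfl⟩ := exists_eq_smul_intComb hf h0
  rw [logHeight_eq_of_primitive hc hb] at hr ⊢
  exact ⟨intComb k c, ⟨c, hc, rfl, hr⟩, rfl⟩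

/-! ### Linear independence and bases -/

theorem basisComb_eq_sum_subtype (k : ℕ) (c : ℕ → ℂ) :
    basisComb k c = ∑ l : Set.Icc 1 k, c l • basisForm k l :=
  Finset.sum_subtype _ (fun l ↦ by rw [Finset.mem_Icc, Set.mem_Icc]) _

theorem linearIndependent_basisForm (k : ℕ) :
    LinearIndependent ℂ fun l : Set.Icc 1 k ↦ basisForm k l := by
  rw [Fintype.linearIndependent_iff]
  intro g hg l
  have h : basisComb k (Function.extend Subtype.val g 0) = 0 := by
    rw [basisComb_eq_sum_subtype, ← hg]
    refine Finset.sum_congr rfl fun l _ ↦ ?_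
    rw [Subtype.val_injective.extend_apply]
  have := basisComb_eq_zero h l (Finset.mem_Icc.2 l.2)
  rwa [Subtype.val_injective.extend_apply] at this

theorem linearIndependent_rat_basisForm (k : ℕ) :
    LinearIndependent ℚ fun l : Set.Icc 1 k ↦ basisForm k l := by
  -- The ℚ-structure is a separate instance, so its compatibility with the ℂ-structure needs
  -- checking.
  have : IsScalarTower ℚ ℂ (CuspForm 𝒮ℒ ((12 * k : ℕ) : ℤ)) :=
    ⟨fun q z f ↦ by rw [rat_smul_eq, Rat.smul_def, mul_smul]⟩
  refine (linearIndependent_basisForm k).restrict_scalars fun a b h ↦ ?_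
  simpa [Rat.smul_def] using h

theorem basisForm_mem_cuspFormsInt (k l : ℕ) : basisForm k l ∈ cuspFormsInt k := fun n ↦ by
  obtain ⟨a, ha⟩ := qCoeff_basisForm_mem (Int.castRingHom ℂ).range k l n
  exact ⟨a, ha.symm⟩

/-- The integral basis `Δ ^ k j ^ (k - l)` of the lattice of integral cusp forms. -/
def cuspFormsIntBasis (k : ℕ) : Module.Basis (Set.Icc 1 k) ℤ (cuspFormsInt k) :=
  Module.Basis.mk
    (v := fun l : Set.Icc 1 k ↦ (⟨basisForm k l, basisForm_mem_cuspFormsInt k l⟩ : cuspFormsInt k))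
    (by
      apply LinearIndependent.of_comp (cuspFormsInt k).subtype
      refine (linearIndependent_basisForm k).restrict_scalars fun a b h ↦ ?_
      simpa using h)
    (by
      rintro ⟨f, hf⟩ -
      obtain ⟨c, rfl⟩ := exists_intComb_of_mem_cuspFormsInt hf
      have e : (⟨intComb k c, hf⟩ : cuspFormsInt k) =
          ∑ l : Set.Icc 1 k, c l • ⟨basisForm k l, basisForm_mem_cuspFormsInt k l⟩ := by
        apply Subtype.ext
        change intComb k c = _
        rw [AddSubmonoidClass.coe_finsetSum, intComb, basisComb_eq_sum_subtype]
        refine Finset.sum_congr rfl fun l _ ↦ ?_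
        exact Int.cast_smul_eq_zsmul ℂ _ _
      rw [e]
      exact Submodule.sum_mem _ fun l _ ↦ Submodule.smul_mem _ _ (Submodule.subset_span ⟨l, rfl⟩))

theorem cuspFormsIntBasis_apply (k : ℕ) (l : Set.Icc 1 k) :
    (cuspFormsIntBasis k l : CuspForm 𝒮ℒ ((12 * k : ℕ) : ℤ)) = basisForm k l := by
  rw [cuspFormsIntBasis, Module.Basis.mk_apply]

theorem rank_cuspFormsInt (k : ℕ) : Module.rank ℤ (cuspFormsInt k) = k := by
  rw [rank_eq_card_basis (cuspFormsIntBasis k)]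
  simp

/-! ### Successive maxima -/

theorem basisForm_ne_zero {k l : ℕ} (h1 : 1 ≤ l) (h2 : l ≤ k) : basisForm k l ≠ 0 := fun h ↦ by
  have := qCoeff_basisForm_self h1 h2
  rw [h, map_zero] at this
  exact zero_ne_one this

theorem mem_heightLevels {k i : ℕ} {r : ℝ} : r ∈ heightLevels k i ↔
    (i : Cardinal) ≤ Module.rank ℚ
      (Submodule.span ℚ {f | f ∈ cuspFormsRat k ∧ f ≠ 0 ∧ r ≤ logHeight k f}) := Iff.rfl

theorem heightLevels_nonempty {k i : ℕ} (hik : i ≤ k) : (heightLevels k i).Nonempty := by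
  -- Any lower bound for the heights of the k basis forms is a level.
  obtain ⟨r, hr⟩ := ((Finset.Icc 1 k).image fun l ↦ logHeight k (basisForm k l)).bddBelow
  refine ⟨r, mem_heightLevels.2 ?_⟩
  have hsub : Set.range (fun l : Set.Icc 1 k ↦ basisForm k l) ⊆
      {f | f ∈ cuspFormsRat k ∧ f ≠ 0 ∧ r ≤ logHeight k f} := by
    rintro _ ⟨l, rfl⟩
    exact ⟨cuspFormsInt_le (basisForm_mem_cuspFormsInt k l), basisForm_ne_zero l.2.1 l.2.2,
      hr (Finset.mem_coe.2 (Finset.mem_image_of_mem _ (Finset.mem_Icc.2 l.2)))⟩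
  have hli := linearIndependent_rat_basisForm k
  have h := Submodule.rank_mono (Submodule.span_mono (R := ℚ) hsub)
  rw [rank_span hli, Cardinal.mk_range_eq _ hli.injective] at h
  refine le_trans ?_ h
  rw [Cardinal.mk_fintype]
  simpa using hik

/-- The span changes only when `r` passes an actual height, so every level can be raised to the next
height; above a fixed `r₀` there are finitely many. -/
theorem exists_isGreatest_heightLevels {k i : ℕ} (hi : 1 ≤ i) (hik : i ≤ k) :
    ∃ M, IsGreatest (heightLevels k i) M := by
  obtain ⟨r₀, hr₀⟩ := heightLevels_nonempty hik
  let Λ : ℝ → Set ℝ := fun r ↦ {x | r ≤ x ∧ ∃ f ∈ cuspFormsRat k, f ≠ 0 ∧ logHeight k f = x}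
  have step : ∀ r ∈ heightLevels k i, r₀ ≤ r → ∃ r' ∈ heightLevels k i ∩ Λ r₀, r ≤ r' := by
    intro r hr hr0
    -- Without a height at or above `r` the span is zero, which `1 ≤ i` excludes.
    have hne : (Λ r).Nonempty := by
      by_contra hemp
      rw [Set.not_nonempty_iff_eq_empty] at hemp
      have hempty : {f | f ∈ cuspFormsRat k ∧ f ≠ 0 ∧ r ≤ logHeight k f} = ∅ := by
        rw [Set.eq_empty_iff_forall_notMem]
        rintro f ⟨h1, h2, h3⟩
        have : logHeight k f ∈ Λ r := ⟨h3, f, h1, h2, rfl⟩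
        rw [hemp] at this
        exact this
      have h := mem_heightLevels.1 hr
      rw [hempty, Submodule.span_empty, rank_bot] at h
      have : i ≤ 0 := by exact_mod_cast h
      omega
    obtain ⟨r', hr', hmin⟩ := Set.exists_min_image (Λ r) id (finite_logHeight k r) hne
    refine ⟨r', ⟨mem_heightLevels.2 ?_, hr0.trans hr'.1, hr'.2⟩, hr'.1⟩
    have hsub : {f | f ∈ cuspFormsRat k ∧ f ≠ 0 ∧ r ≤ logHeight k f} ⊆
        {f | f ∈ cuspFormsRat k ∧ f ≠ 0 ∧ r' ≤ logHeight k f} :=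
      fun f hf ↦ ⟨hf.1, hf.2.1, hmin _ ⟨hf.2.2, f, hf.1, hf.2.1, rfl⟩⟩
    exact (mem_heightLevels.1 hr).trans (Submodule.rank_mono (Submodule.span_mono hsub))
  have hfin : (heightLevels k i ∩ Λ r₀).Finite :=
    (finite_logHeight k r₀).subset Set.inter_subset_right
  obtain ⟨r₁, hr₁, -⟩ := step r₀ hr₀ le_rfl
  obtain ⟨M, hM, hmax⟩ := Set.exists_max_image _ id hfin ⟨r₁, hr₁⟩
  refine ⟨M, hM.1, fun r hr ↦ ?_⟩
  rcases le_total r₀ r with h | h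
  · obtain ⟨r', hr', hle⟩ := step r hr h
    exact hle.trans (hmax r' hr')
  · exact h.trans hM.2.1

theorem isGreatest_succMax {k i : ℕ} (hi : 1 ≤ i) (hik : i ≤ k) :
    IsGreatest (heightLevels k i) (succMax k i) := by
  obtain ⟨M, hM⟩ := exists_isGreatest_heightLevels hi hik
  rw [succMax, hM.csSup_eq]
  exact hM

theorem eq_zero_of_qCoeff_intComb {k m : ℕ} {c : ℕ → ℤ}
    (h : ∀ n < m, qCoeff n (intComb k c) = 0) : ∀ l ∈ Finset.Icc 1 k, l < m → c l = 0 := by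
  intro l
  induction l using Nat.strong_induction_on with | _ l ih =>
  intro hl hlm
  rw [Finset.mem_Icc] at hl
  have := qCoeff_basisComb_of_forall_lt (c := fun l ↦ (c l : ℂ)) hl.1 hl.2 fun j hj hjl ↦ by
    rw [ih j hjl hj (hjl.trans hlm), Int.cast_zero]
  rw [← intComb, h l hlm] at this
  exact_mod_cast this.symm

/-- A form of order at least `m` is a combination of the basis forms of index at least `m`. -/
theorem mem_span_basisForm {k m : ℕ} {f : CuspForm 𝒮ℒ ((12 * k : ℕ) : ℤ)}
    (hf : f ∈ cuspFormsRat k) (h0 : f ≠ 0) (hm : m ≤ ordInfty f) :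
    f ∈ Submodule.span ℚ (basisForm k '' (Finset.Icc m k : Set ℕ)) := by
  obtain ⟨b, c, hb, hc, rfl⟩ := exists_eq_smul_intComb hf h0
  rw [ordInfty_smul hc.intComb_ne_zero hb] at hm
  have hz := eq_zero_of_qCoeff_intComb (m := m) fun n hn ↦
    (ordInfty_spec hc.intComb_ne_zero).2.2.2 n (hn.trans_le hm)
  refine Submodule.smul_mem _ _ ?_
  rw [intComb, basisComb]
  refine Submodule.sum_mem _ fun l hl ↦ ?_
  rcases lt_or_ge l m with h | h
  · rw [hz l hl h, Int.cast_zero, zero_smul]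
    exact Submodule.zero_mem _
  · rw [show ((c l : ℤ) : ℂ) = ((c l : ℚ) : ℂ) by norm_cast, ← rat_smul_eq]
    refine Submodule.smul_mem _ _ (Submodule.subset_span ⟨l, ?_, rfl⟩)
    exact Finset.mem_coe.2 (Finset.mem_Icc.2 ⟨h, (Finset.mem_Icc.1 hl).2⟩)

/-- Forms of order at least `m` lie in the span of the basis forms with indices from m to k, which
caps the dimension. -/
theorem le_of_mem_heightLevels {k i m : ℕ} {r : ℝ} (hr : r ∈ heightLevels k i)
    (h : ∀ f ∈ cuspFormsRat k, f ≠ 0 → r ≤ logHeight k f → m ≤ ordInfty f) : i ≤ k + 1 - m := by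
  classical
  have hle : Submodule.span ℚ {f | f ∈ cuspFormsRat k ∧ f ≠ 0 ∧ r ≤ logHeight k f} ≤
      Submodule.span ℚ (((Finset.Icc m k).image (basisForm k) : Finset _) : Set _) := by
    rw [Submodule.span_le, Finset.coe_image]
    rintro f ⟨h1, h2, h3⟩
    exact mem_span_basisForm h1 h2 (h f h1 h2 h3)
  have h2 := ((mem_heightLevels.1 hr).trans (Submodule.rank_mono hle)).trans
    (rank_span_finset_le _)
  have h3 : i ≤ ((Finset.Icc m k).image (basisForm k)).card := by exact_mod_cast h2
  exact (h3.trans Finset.card_image_le).trans (by rw [Nat.card_Icc])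

/-! ### The function `ℓ` -/

theorem strictMonoOn_ellBound : StrictMonoOn ellBound (Set.Ioi 0) := by
  intro x hx y _ hxy
  have h1 := Real.log_lt_log hx hxy
  have h2 : 2 * Real.pi * x < 2 * Real.pi * y := by
    have := Real.pi_pos
    gcongr
  rw [ellBound, ellBound]
  linarith

theorem ellBound_le {x y : ℝ} (hx : 0 < x) (hxy : x ≤ y) : ellBound x ≤ ellBound y :=
  strictMonoOn_ellBound.monotoneOn hx (hx.trans_le hxy) hxy

theorem tendsto_ellBound : Tendsto ellBound (𝓝[>] 0) atBot := by
  have h1 : Tendsto (fun c : ℝ ↦ 2 * Real.pi * c) (𝓝[>] 0) (𝓝 (2 * Real.pi * 0)) :=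
    (tendsto_id.mono_left nhdsWithin_le_nhds).const_mul _
  have h2 : Tendsto (fun c : ℝ ↦ 6 * (Real.log c + (1 - Real.log 12))) (𝓝[>] 0) atBot :=
    (tendsto_atBot_add_const_right _ _ Real.tendsto_log_nhdsGT_zero).const_mul_atBot (by norm_num)
  refine (h1.add_atBot h2).congr fun c ↦ ?_
  rw [ellBound]
  ring

theorem ellBound_one : ellBound 1 = 2 * Real.pi + 6 * (1 - Real.log 12) := by
  rw [ellBound, Real.log_one]
  ring

theorem log_twelve : Real.log 12 = 2 * Real.log 2 + Real.log 3 := by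
  rw [show (12 : ℝ) = 2 ^ 2 * 3 by norm_num, Real.log_mul (by norm_num) (by norm_num),
    Real.log_pow]
  norm_num

theorem ellBound_one_bounds : -2.62626 < ellBound 1 ∧ ellBound 1 < -2.62625 := by
  rw [ellBound_one, log_twelve]
  have h1 := Real.log_two_gt_d9
  have h2 := Real.log_two_lt_d9
  have h3 := Real.log_three_gt_d9
  have h4 := Real.log_three_lt_d9
  have h5 := Real.pi_gt_d6
  have h6 := Real.pi_lt_d6
  constructor <;> norm_num at * <;> linarith

theorem continuousAt_ellBound {c : ℝ} (hc : 0 < c) : ContinuousAt ellBound c := by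
  have := Real.continuousAt_log hc.ne'
  unfold ellBound
  fun_prop

/-! ### Small successive maxima and the finite exceptional set -/

theorem eventually_card_succMax_le {c : ℝ} (hc : 0 < c) (hc1 : c < 1) {ε : ℝ} (hε : 0 < ε) :
    ∀ᶠ k : ℕ in atTop,
      c * k ≤ ({i ∈ Finset.Icc 1 k | succMax k i / k ≤ ellBound c + ε}.card : ℝ) := by
  -- The room between `c` and `c'` absorbs the rounding in ⌊c'k⌋, once (c' - c)k ≥ 1.
  obtain ⟨c', hc', hℓ⟩ : ∃ c' > c, ellBound c' < ellBound c + ε / 2 := by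
    have h := (continuousAt_ellBound hc).eventually_lt_const
      (show ellBound c < ellBound c + ε / 2 by linarith)
    have h' := (h.filter_mono (nhdsWithin_le_nhds (s := Set.Ioi c))).and self_mem_nhdsWithin
    obtain ⟨x, hx, hx'⟩ := h'.exists
    exact ⟨x, hx', hx⟩
  have h1 := tendsto_heightError.eventually_lt_const (show (0 : ℝ) < ε / 2 by linarith)
  have h2 := tendsto_natCast_atTop_atTop (R := ℝ) |>.eventually_ge_atTop (1 / (c' - c))
  filter_upwards [h1, h2, eventually_ge_atTop 1] with k hk1 hk2 hk3
  have hk0 : (0 : ℝ) < k := by exact_mod_cast hk3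
  set N := ⌊c' * k⌋₊ with hN
  have hNc : c * k ≤ N := by
    have := Nat.lt_floor_add_one (c' * k)
    rw [div_le_iff₀ (by linarith)] at hk2
    have e : (k : ℝ) * (c' - c) = c' * k - c * k := by ring
    rw [e] at hk2
    linarith
  -- If one of these top indices had a larger maximum, every form of at least that height would have
  -- order above N, forcing i ≤ k - N.
  have hsub : Finset.Icc (k - N + 1) k ⊆
      {i ∈ Finset.Icc 1 k | succMax k i / k ≤ ellBound c + ε} := by
    intro i hi
    rw [Finset.mem_Icc] at hi
    have hi1 : 1 ≤ i := by omega
    rw [Finset.mem_filter, Finset.mem_Icc]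
    refine ⟨⟨hi1, hi.2⟩, ?_⟩
    by_contra! hlt
    have hle := le_of_mem_heightLevels (m := N + 1) (isGreatest_succMax hi1 hi.2).1 ?_
    · omega
    intro f hf h0 hr
    by_contra! hord
    have hb := logHeight_div_le hf h0
    have hm1 := (ordInfty_spec h0).1
    have hm : (0 : ℝ) < ordInfty f := by exact_mod_cast hm1
    have hle : (ordInfty f : ℝ) / k ≤ c' := by
      rw [div_le_iff₀ hk0]
      exact (Nat.cast_le.2 (Nat.lt_succ_iff.1 hord)).trans (Nat.floor_le (by nlinarith))
    have hmono := ellBound_le (div_pos hm hk0) hle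
    have hr' : succMax k i / k ≤ logHeight k f / k := by gcongr
    linarith
  have hcard := Finset.card_le_card hsub
  rw [Nat.card_Icc] at hcard
  refine le_trans ?_ (Nat.cast_le.2 hcard)
  -- `c'` may exceed 1, so N may exceed k; then all k indices qualify and c < 1 suffices.
  rcases le_total N k with h | h
  · rwa [show k + 1 - (k - N + 1) = N by omega]
  · rw [show k + 1 - (k - N + 1) = k by omega]
    nlinarith

theorem exists_finite_exceptions {ε : ℝ} (hε : 0 < ε) :
    ∃ T : Set (Σ k : ℕ, CuspForm 𝒮ℒ ((12 * k : ℕ) : ℤ)), T.Finite ∧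
      ∀ k : ℕ, 1 ≤ k → ∀ f ∈ cuspFormsInt k, f ≠ 0 →
        ε ≤ logHeight k f / k - ellBound ((ordInfty f : ℝ) / k) →
        ∃ g, (⟨k, g⟩ : Σ k : ℕ, CuspForm 𝒮ℒ ((12 * k : ℕ) : ℤ)) ∈ T ∧
          ∃ a : ℚ, a ≠ 0 ∧ f = a • g := by
  obtain ⟨K, hK⟩ := eventually_atTop.1 (tendsto_heightError.eventually_lt_const hε)
  -- As ord_∞ ≥ 1 and ℓ is increasing, an exceptional form has height at least k ℓ(1/k), a threshold
  -- depending on k alone.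
  refine ⟨⋃ k ∈ Set.Iio K, Sigma.mk k '' primitiveForms k (k * ellBound (1 / k)),
    (Set.finite_Iio K).biUnion fun k _ ↦ (finite_primitiveForms k _).image _, ?_⟩
  intro k hk f hf h0 hle
  have hub := logHeight_div_le (cuspFormsInt_le hf) h0
  have hkK : k < K := by
    by_contra! h
    have := hK k h
    linarith
  have hk0 : (0 : ℝ) < k := by exact_mod_cast hk
  have hm : (1 : ℝ) ≤ ordInfty f := by exact_mod_cast (ordInfty_spec h0).1
  have hmono : ellBound (1 / k) ≤ ellBound ((ordInfty f : ℝ) / k) :=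
    ellBound_le (by positivity) (by gcongr)
  have hr : k * ellBound (1 / k) ≤ logHeight k f := by
    rw [mul_comm, ← le_div_iff₀ hk0]
    linarith
  obtain ⟨b, c, hb, hc, rfl⟩ := exists_eq_smul_intComb (cuspFormsInt_le hf) h0
  rw [logHeight_eq_of_primitive hc hb] at hr
  exact ⟨intComb k c, Set.mem_biUnion (Set.mem_Iio.2 hkK) ⟨_, ⟨c, hc, rfl, hr⟩, rfl⟩, b, hb, rfl⟩

end

/-! ### The main theorem -/

theorem mainTheorem2 :
    -- the lattice has rank `k`, with basis `Δ ^ k j ^ (k - l)` for `1 ≤ l ≤ k`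
    (∀ k : ℕ, 1 ≤ k →
      Module.rank ℤ (cuspFormsInt k) = k ∧
      ∃ b : Module.Basis (Set.Icc 1 k) ℤ (cuspFormsInt k), ∀ (l : Set.Icc 1 k) (z : ℍ),
        (b l : CuspForm 𝒮ℒ ((12 * k : ℕ) : ℤ)) z
          = ModularForm.discriminant z ^ k * kleinJ z ^ (k - (l : ℕ))) ∧
    -- the range of `ord_∞(f) / k`, and invariance under nonzero rational multiples
    (∀ k : ℕ, 1 ≤ k → ∀ f ∈ cuspFormsInt k, f ≠ 0 →
      1 / (k : ℝ) ≤ (ordInfty f : ℝ) / k ∧ (ordInfty f : ℝ) / k ≤ 1 ∧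
      ∀ a : ℚ, a ≠ 0 → logHeight k (a • f) = logHeight k f ∧ ordInfty (a • f) = ordInfty f) ∧
    -- `ℓ` is increasing on the positive reals
    StrictMonoOn ellBound (Set.Ioi 0) ∧
    -- (i)
    (∀ ε : ℝ, 0 < ε →
      ∃ T : Set (Σ k : ℕ, CuspForm 𝒮ℒ ((12 * k : ℕ) : ℤ)), T.Finite ∧
        ∀ k : ℕ, 1 ≤ k → ∀ f ∈ cuspFormsInt k, f ≠ 0 →
          ε ≤ logHeight k f / k - ellBound ((ordInfty f : ℝ) / k) →
          ∃ g, (⟨k, g⟩ : Σ k : ℕ, CuspForm 𝒮ℒ ((12 * k : ℕ) : ℤ)) ∈ T ∧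
            ∃ a : ℚ, a ≠ 0 ∧ f = a • g) ∧
    -- (ii)
    (ellBound 1 = 2 * Real.pi + 6 * (1 - Real.log 12) ∧
      -2.62626 < ellBound 1 ∧ ellBound 1 < -2.62625 ∧
      ∀ r₀ : ℝ, ellBound 1 < r₀ →
        ∀ᶠ k : ℕ in atTop, ∀ f ∈ cuspFormsInt k, f ≠ 0 → logHeight k f / k ≤ r₀) ∧
    -- (iii), preceded by the existence of the successive maxima
    (∀ k i : ℕ, 1 ≤ i → i ≤ k → IsGreatest (heightLevels k i) (succMax k i)) ∧
    (∀ c : ℝ, 0 < c → c < 1 → ∀ ε : ℝ, 0 < ε →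
      ∀ᶠ k : ℕ in atTop,
        c * k ≤ ({i ∈ Finset.Icc 1 k | succMax k i / k ≤ ellBound c + ε}.card : ℝ)) ∧
    Tendsto ellBound (𝓝[>] 0) atBot := by
  refine ⟨fun k _ ↦ ⟨rank_cuspFormsInt k, cuspFormsIntBasis k, fun l z ↦ ?_⟩,
    fun k hk f hf h0 ↦ ?_, strictMonoOn_ellBound, fun ε hε ↦ exists_finite_exceptions hε,
    ⟨ellBound_one, ellBound_one_bounds.1, ellBound_one_bounds.2, fun r₀ hr₀ ↦ ?_⟩,
    fun k i hi hik ↦ isGreatest_succMax hi hik,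
    fun c hc hc1 ε hε ↦ eventually_card_succMax_le hc hc1 hε, tendsto_ellBound⟩
  · rw [cuspFormsIntBasis_apply, basisForm_apply_kleinJ l.2.1 l.2.2]
  · have hk0 : (0 : ℝ) < k := by exact_mod_cast hk
    obtain ⟨h1, h2, -, -⟩ := ordInfty_spec h0
    refine ⟨?_, ?_, fun a ha ↦ ⟨logHeight_smul (cuspFormsInt_le hf) h0 ha, ordInfty_smul h0 ha⟩⟩
    · gcongr
      exact_mod_cast h1
    · rw [div_le_one hk0]
      exact_mod_cast h2
  -- For large k the error falls below the gap r₀ - ℓ(1).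
  · filter_upwards [tendsto_heightError.eventually_lt_const (sub_pos.2 hr₀),
      eventually_ge_atTop 1] with k hk hk1 f hf h0
    have hk0 : (0 : ℝ) < k := by exact_mod_cast hk1
    obtain ⟨h1, h2, -, -⟩ := ordInfty_spec h0
    have hb := logHeight_div_le (cuspFormsInt_le hf) h0
    have hm : (0 : ℝ) < ordInfty f := by exact_mod_cast h1
    have hle : ellBound ((ordInfty f : ℝ) / k) ≤ ellBound 1 :=
      ellBound_le (by positivity) (by rw [div_le_one hk0]; exact_mod_cast h2)
    linarith
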